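/- Let $H$ be a real separable Hilbert space, let $T : H \to H$ be a self-adjoint positive semi-definite trace-class operator with principal square root $T^{1/2}$, let $k, p \ge 0$ be integers, and assume that $T$ has rank at least $k+p+2$. For $y_1,\dots,y_{k+p} \in H$ let $P_{[y_1,\dots,y_{k+p}]}$ denote the orthogonal projection onto $\mathrm{span}\{y_1,\dots,y_{k+p}\}$. For an orthonormal system $w_1,\dots,w_n$ in $H$ let $W_n : \mathbb{R}^n \to H$, $W_n\xi = \sum_{i=1}^n \xi_i w_i$, and consider the centred Gaussian measures $$\mu_n = \mathcal{N}_H(0, T^{1/2} W_n W_n^* T^{1/2}), \qquad \mu = \mathcal{N}_H(0, T)$$ on $H$. Let $\Gamma(\mu_n,\mu)$ be the set of Borel probability measures on $H \times H$ with first marginal $\mu_n$ and second marginal $\mu$. For $\gamma \in \Gamma(\mu_n,\mu)$ let $(y_{n,j}, y_j)$, $j = 1,\dots,k+p$, be independent pairs with law $\gamma$, put $Y = [y_1,\dots,y_{k+p}]$ and $Y_n = [y_{n,1},\dots,y_{n,k+p}]$, and let $$\widehat T = T^{1/2} P_Y T^{1/2}, \qquad \widehat T_n = T^{1/2} P_{Y_n}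 T^{1/2}$$ be the Nyström approximation with $k+p$ samples and its discretized version. (If $Y_n = T^{1/2} W_n \Omega_n$ for an $n \times (k+p)$ Gaussian matrix $\Omega_n$, then $\widehat T_n = T W_n\Omega_n(\Omega_n^* W_n^* T W_n \Omega_n)^\dagger (T W_n\Omega_n)^*$.) Then: 1. There is a constant $C$, depending only on $T$, $k$ and $p$ (in particular independent of $n$), such that for every $n$ and every orthonormal system $w_1,\dots,w_n$ in $H$ $$\inf_{\gamma \in \Gamma(\mu_n,\mu)} \mathbb{E}\,\|\widehat T - \widehat T_n\|_{\mathrm{HS}} \le C\,\bigl[\mathrm{Tr}(T) - \mathrm{Tr}(W_n^* T W_n)\bigr],$$ where the expectation is taken with respect to $\gamma^{\otimes (k+p)}$ and $\|\cdot\|_{\mathrm{HS}}$ is the Hilbert–Schmidt norm. 2. If $\{w_i\}_{i \ge 1}$ is a complete orthonormal system of $H$ and $W_n$ is formed from $w_1,\dots,w_n$, then $$\lim_{n\to\infty}\ \inf_{\gamma \in \Gamma(\mu_n,\mu)} \mathbb{E}\,\|\widehat T - \widehat T_n\|_{\mathrm{HS}} = 0.$$ -/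

import Mathlib

open MeasureTheory ProbabilityTheory Filter Topology
open scoped ENNReal NNReal RealInnerProductSpace

namespace Nystrom

/-! ### Operators on a real Hilbert space -/

section Operators

universe u

variable {H : Type u} [NormedAddCommGroup H] [InnerProductSpace ℝ H]

/-- `T` is a trace-class operator: it has a singular value decomposition
`T = ∑ᵢ σᵢ ⟨vᵢ, ·⟩ uᵢ` with orthonormal systems `u`, `v` and singular values `σᵢ ≥ 0` such that
`∑ᵢ σᵢ < ∞`. -/
def IsTraceClass (T : H →L[ℝ] H) : Prop :=
  ∃ (ι : Type) (u v : ι → H) (σ : ι → ℝ), Orthonormal ℝ u ∧ Orthonormal ℝ v ∧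
    (∀ i, 0 ≤ σ i) ∧ Summable σ ∧ ∀ x, HasSum (fun i => (σ i * ⟪v i, x⟫) • u i) (T x)

theorem exists_diagonal {ι : Type*} (b : HilbertBasis ι ℝ H) (d : ι → ℝ) (C : ℝ)
    (hd : ∀ i, |d i| ≤ C) : ∃ S : H →L[ℝ] H, ∀ x i, ⟪b i, S x⟫ = d i * ⟪b i, x⟫ := by
  have hmem : ∀ f : lp (fun _ : ι => ℝ) 2, Memℓp (fun i => d i * f i) 2 := fun f => by
    refine memℓp_gen ?_
    have hf := (memℓp_gen_iff (p := 2) (by norm_num)).1 (lp.memℓp f)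
    refine Summable.of_nonneg_of_le (fun i => by positivity) (fun i => ?_) (hf.mul_left (C ^ 2))
    have : C ^ 2 * ‖f i‖ ^ (2 : ℝ≥0∞).toReal = (C * ‖f i‖) ^ (2 : ℝ≥0∞).toReal := by
      simp [mul_pow]
    rw [this, norm_mul]
    gcongr
    exact hd i
  let L : lp (fun _ : ι => ℝ) 2 →ₗ[ℝ] lp (fun _ : ι => ℝ) 2 :=
    { toFun := fun f => ⟨fun i => d i * f i, hmem f⟩
      map_add' := fun f g => by ext i; exact mul_add _ _ _
      map_smul' := fun c f => by ext i; simp; ring }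
  have hL : ∀ f, ‖L f‖ ≤ |C| * ‖f‖ := fun f => by
    have h2 : (0 : ℝ) < (2 : ℝ≥0∞).toReal := by norm_num
    have h := lp.norm_le_of_forall_sum_le h2 (C := |C| * ‖f‖) (f := L f) (by positivity) ?_
    · exact h
    intro s
    have h3 := lp.sum_rpow_le_norm_rpow h2 f s
    simp only [ENNReal.toReal_ofNat, Real.rpow_ofNat] at h3 ⊢
    calc ∑ i ∈ s, ‖L f i‖ ^ 2 ≤ ∑ i ∈ s, |C| ^ 2 * ‖f i‖ ^ 2 := by
          refine Finset.sum_le_sum fun i _ => ?_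
          rw [← mul_pow]
          have : ‖L f i‖ = |d i| * ‖f i‖ := by simp [L]
          rw [this]
          exact pow_le_pow_left₀ (by positivity) (mul_le_mul_of_nonneg_right
            ((hd i).trans (le_abs_self C)) (norm_nonneg _)) 2
      _ = |C| ^ 2 * ∑ i ∈ s, ‖f i‖ ^ 2 := by rw [Finset.mul_sum]
      _ ≤ _ := by rw [mul_pow]; gcongr
  let D := L.mkContinuous |C| hL
  refine ⟨(b.repr.symm : _ →L[ℝ] H) ∘L D ∘L (b.repr : H →L[ℝ] _), fun x i => ?_⟩
  rw [← b.repr_apply_apply, ← b.repr_apply_apply]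
  simp [D, L]

theorem ext_basis {ι : Type*} (b : HilbertBasis ι ℝ H) {x y : H}
    (h : ∀ i, ⟪b i, x⟫ = ⟪b i, y⟫) : x = y := by
  apply b.repr.injective
  ext i
  rw [b.repr_apply_apply, b.repr_apply_apply, h]

theorem enorm_sq_eq {ι : Type*} (b : HilbertBasis ι ℝ H) (x : H) :
    ‖x‖ₑ ^ 2 = ∑' i, ‖⟪b i, x⟫‖ₑ ^ 2 := by
  have h := b.hasSum_inner_mul_inner x x
  have h' : HasSum (fun i => ‖⟪b i, x⟫‖ ^ 2) (‖x‖ ^ 2) := by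
    rw [← real_inner_self_eq_norm_sq]
    refine h.congr_fun fun i => ?_
    rw [real_inner_comm (b i) x, Real.norm_eq_abs, sq_abs, sq]
  have e : ∀ {E : Type _} [NormedAddCommGroup E] (y : E), ‖y‖ₑ ^ 2 = ENNReal.ofReal (‖y‖ ^ 2) := by
    intro E _ y
    rw [ENNReal.ofReal_pow (norm_nonneg _), ofReal_norm]
  rw [e, ← h'.tsum_eq, ENNReal.ofReal_tsum_of_nonneg (fun i => by positivity) h'.summable]
  refine tsum_congr fun i => ?_
  rw [ENNReal.ofReal_pow (norm_nonneg _), ofReal_norm]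

variable [CompleteSpace H]

theorem IsTraceClass.isCompactOperator {T : H →L[ℝ] H} (hT : IsTraceClass T) :
    IsCompactOperator T := by
  obtain ⟨ι, u, v, σ, hu, hv, h0, hs, h⟩ := hT
  let F : ι → H →L[ℝ] H := fun i => σ i • (innerSL ℝ (v i)).smulRight (u i)
  have hF : Summable F := by
    refine Summable.of_norm (hs.congr fun i => ?_)
    simp [F, norm_smul, ContinuousLinearMap.norm_smulRight_apply, hu.1 i, hv.1 i,
      abs_of_nonneg (h0 i)]
  have hFT : HasSum F T := by
    have h1 : (∑' i, F i) = T := by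
      ext x
      have h2 := hF.hasSum.mapL (ContinuousLinearMap.apply ℝ H x)
      refine HasSum.unique h2 ((h x).congr_fun ?_)
      intro i
      simp [F, mul_smul]
    rw [← h1]
    exact hF.hasSum
  refine isCompactOperator_of_tendsto hFT (Eventually.of_forall fun s => ?_)
  have hc : ∀ i, IsCompactOperator (F i) := fun i => by
    have : F i = (ContinuousLinearMap.toSpanSingleton ℝ (σ i • u i)) ∘L (innerSL ℝ (v i)) := by
      ext x
      simp [F, smul_smul, mul_comm]
    rw [this]
    exact (isCompactOperator_of_locallyCompactSpace_rng
      (ContinuousLinearMap.toSpanSingleton ℝ (σ i • u i))).comp_clm _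
  exact (compactOperator (RingHom.id ℝ) H H).sum_mem fun i _ => hc i

theorem exists_eigenbasis {T : H →L[ℝ] H} (hpos : T.IsPositive) (hc : IsCompactOperator T) :
    ∃ (ι : Type u) (b : HilbertBasis ι ℝ H) (l : ι → ℝ), (∀ i, 0 ≤ l i) ∧
      ∀ i, T (b i) = l i • b i := by
  have hsym : (T : H →ₗ[ℝ] H).IsSymmetric := hpos.isSymmetric
  let G : ℝ → Submodule ℝ H := fun c => Module.End.eigenspace (T : Module.End ℝ H) c
  have hGc : ∀ c, CompleteSpace (G c) := fun c => by
    have : IsClosed (G c : Set H) := by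
      have : (G c : Set H) = {x | T x = c • x} := by
        ext x; simp [G]
      rw [this]
      exact isClosed_eq T.continuous (continuous_const_smul c)
    exact this.completeSpace_coe
  choose K e _ using fun c => exists_hilbertBasis ℝ (G c)
  have ho : OrthogonalFamily ℝ (fun c => G c) fun c => (G c).subtypeₗᵢ :=
    hsym.orthogonalFamily_eigenspaces
  have hon := ho.orthonormal_sigma_orthonormal (v_family := fun c => (e c : _ → G c))
    fun c => (e c).orthonormal
  have hbot : (Submodule.span ℝ (Set.range fun a : Σ c, K c =>
      (G a.1).subtypeₗᵢ (e a.1 a.2)))ᗮ = ⊥ := by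
    rw [eq_bot_iff, ← ContinuousLinearMap.orthogonalComplement_iSup_eigenspaces_eq_bot hc hsym]
    intro x hx
    rw [Submodule.mem_orthogonal] at hx ⊢
    have hx2 : ∀ c, ∀ y : G c, ⟪(y : H), x⟫ = 0 := by
      intro c y
      have hcl := (e c).dense_span
      have hy : y ∈ (Submodule.span ℝ (Set.range (e c))).topologicalClosure := by
        rw [hcl]; trivial
      have hsub : (Submodule.span ℝ (Set.range (e c))).topologicalClosure ≤
          LinearMap.ker ((innerSL ℝ x) ∘L (G c).subtypeL).toLinearMap := by
        apply Submodule.topologicalClosure_minimal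
        · rw [Submodule.span_le]
          rintro _ ⟨i, rfl⟩
          have := hx _ (Submodule.subset_span ⟨⟨c, i⟩, rfl⟩)
          simpa [real_inner_comm] using this
        · exact ContinuousLinearMap.isClosed_ker ((innerSL ℝ x) ∘L (G c).subtypeL)
      have := hsub hy
      simpa [real_inner_comm] using this
    intro z hz
    have : (⨆ c, Module.End.eigenspace (T : Module.End ℝ H) c) ≤
        LinearMap.ker (innerSL ℝ x).toLinearMap := by
      refine iSup_le fun c y hy => ?_
      have := hx2 c ⟨y, hy⟩
      simpa [real_inner_comm] using this
    have := this hz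
    simpa [real_inner_comm] using this
  let b := HilbertBasis.mkOfOrthogonalEqBot hon hbot
  have hb : ∀ i, T (b i) = i.1 • b i := fun i => by
    have h1 : b i = (e i.1 i.2 : G i.1) := by simp [b]
    rw [h1]
    exact Module.End.mem_eigenspace_iff.1 (e i.1 i.2).2
  refine ⟨_, b, fun i => i.1, fun i => ?_, hb⟩
  have h1 := hpos.inner_nonneg_left (b i)
  rw [hb i, inner_smul_left, real_inner_self_eq_norm_sq, b.orthonormal.1 i] at h1
  simpa using h1

theorem exists_sqrt {T : H →L[ℝ] H} (hpos : T.IsPositive) (hc : IsCompactOperator T) :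
    ∃ S : H →L[ℝ] H, S.IsPositive ∧ S ∘L S = T := by
  obtain ⟨ι, b, l, hl, hb⟩ := exists_eigenbasis hpos hc
  have hlC : ∀ i, l i ≤ ‖T‖ := fun i => by
    have := T.le_opNorm (b i)
    rw [hb i, norm_smul, b.orthonormal.1 i] at this
    simpa [abs_of_nonneg (hl i)] using this
  obtain ⟨S, hS⟩ := exists_diagonal b (fun i => √(l i)) (√‖T‖) fun i => by
    rw [abs_of_nonneg (Real.sqrt_nonneg _)]
    exact Real.sqrt_le_sqrt (hlC i)
  have hTb : ∀ x i, ⟪b i, T x⟫ = l i * ⟪b i, x⟫ := fun x i => by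
    have := hpos.isSymmetric (b i) x
    simp only [ContinuousLinearMap.coe_coe] at this
    rw [← this, hb i, real_inner_smul_left]
  refine ⟨S, (ContinuousLinearMap.isPositive_iff _).2 ⟨fun x y => ?_, fun x => ?_⟩, ?_⟩
  · simp only [ContinuousLinearMap.coe_coe]
    rw [← b.tsum_inner_mul_inner, ← b.tsum_inner_mul_inner]
    refine tsum_congr fun i => ?_
    rw [real_inner_comm, hS, hS, real_inner_comm x]
    ring
  · rw [← b.tsum_inner_mul_inner]
    refine tsum_nonneg fun i => ?_
    rw [real_inner_comm, hS, mul_assoc]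
    exact mul_nonneg (Real.sqrt_nonneg _) (mul_self_nonneg _)
  · ext x
    refine ext_basis b fun i => ?_
    rw [ContinuousLinearMap.comp_apply, hS, hS, hTb, ← mul_assoc, Real.mul_self_sqrt (hl i)]

theorem sqrt_unique {T S S' : H →L[ℝ] H} (hpos : T.IsPositive) (hc : IsCompactOperator T)
    (hS : S.IsPositive) (hST : S ∘L S = T) (hS' : S'.IsPositive) (hST' : S' ∘L S' = T) :
    S = S' := by
  obtain ⟨ι, b, l, hl, hb⟩ := exists_eigenbasis hpos hc
  have key : ∀ R : H →L[ℝ] H, R.IsPositive → R ∘L R = T → ∀ i, R (b i) = √(l i) • b i := by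
    intro R hR hRT i
    have hRR : ∀ x, R (R x) = T x := fun x => by rw [← hRT]; rfl
    set z := R (b i) - √(l i) • b i with hz
    have h1 : R z + √(l i) • z = 0 := by
      rw [hz, map_sub, map_smul, hRR, hb i, smul_sub, smul_smul, Real.mul_self_sqrt (hl i)]
      abel
    have h2 : ⟪R z, z⟫ + √(l i) * ‖z‖ ^ 2 = 0 := by
      rw [← real_inner_self_eq_norm_sq, ← real_inner_smul_left, ← inner_add_left, h1,
        inner_zero_left]
    have h3 := hR.inner_nonneg_left z
    rcases (Real.sqrt_nonneg (l i)).eq_or_lt with h | h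
    · have h0 : l i = 0 := (Real.sqrt_eq_zero (hl i)).1 h.symm
      have h4 : ⟪R (b i), R (b i)⟫ = 0 := by
        have := hR.isSymmetric (R (b i)) (b i)
        simp only [ContinuousLinearMap.coe_coe] at this
        rw [← this, hRR, hb i, h0, zero_smul, inner_zero_left]
      rw [← h, zero_smul]
      exact inner_self_eq_zero.1 h4
    · have h4 : ‖z‖ ^ 2 = 0 := by
        by_contra hne
        have : 0 < ‖z‖ ^ 2 := lt_of_le_of_ne (by positivity) (Ne.symm hne)
        nlinarith [mul_pos h this]
      have : z = 0 := by simpa using h4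
      exact sub_eq_zero.1 this
  ext x
  refine ext_basis b fun i => ?_
  have e1 := hS.isSymmetric (b i) x
  have e2 := hS'.isSymmetric (b i) x
  simp only [ContinuousLinearMap.coe_coe] at e1 e2
  rw [← e1, ← e2, key S hS hST, key S' hS' hST']

theorem tsum_enorm_sq_eq {ι κ : Type*} (b : HilbertBasis ι ℝ H) (c : HilbertBasis κ ℝ H)
    (A : H →L[ℝ] H) : ∑' i, ‖A (b i)‖ₑ ^ 2 = ∑' j, ‖A.adjoint (c j)‖ₑ ^ 2 := by
  simp_rw [enorm_sq_eq c (A _), enorm_sq_eq b (A.adjoint _)]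
  rw [ENNReal.tsum_comm]
  simp_rw [ContinuousLinearMap.adjoint_inner_right, real_inner_comm]

/-- The index set of a chosen orthonormal basis of `H`. -/
noncomputable def onbIndex (H : Type*) [NormedAddCommGroup H] [InnerProductSpace ℝ H]
    [CompleteSpace H] : Set H :=
  (exists_hilbertBasis ℝ H).choose

/-- A chosen orthonormal basis of `H`. -/
noncomputable def onb (H : Type*) [NormedAddCommGroup H] [InnerProductSpace ℝ H]
    [CompleteSpace H] : HilbertBasis (onbIndex H) ℝ H :=
  (exists_hilbertBasis ℝ H).choose_spec.choose

/-- The Hilbert–Schmidt norm `(∑ᵢ ‖A eᵢ‖²)^{1/2}`, with value `∞` if `A` is not Hilbert–Schmidt.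
It does not depend on the orthonormal basis, see `hsNorm_eq`. -/
noncomputable def hsNorm (A : H →L[ℝ] H) : ℝ≥0∞ :=
  (∑' i, ‖A (onb H i)‖ₑ ^ 2) ^ (1 / 2 : ℝ)

/-- The Hilbert–Schmidt norm can be computed in any orthonormal basis. -/
theorem hsNorm_eq {ι : Type*} (b : HilbertBasis ι ℝ H) (A : H →L[ℝ] H) :
    hsNorm A = (∑' i, ‖A (b i)‖ₑ ^ 2) ^ (1 / 2 : ℝ) := by
  rw [hsNorm, tsum_enorm_sq_eq (onb H) b, tsum_enorm_sq_eq b b,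
    ContinuousLinearMap.adjoint_adjoint]

/-- The trace `∑ᵢ ⟨eᵢ, T eᵢ⟩` of a trace-class operator `T`. It does not depend on
the orthonormal basis, see `opTrace_eq`. -/
noncomputable def opTrace (T : H →L[ℝ] H) : ℝ :=
  ∑' i, ⟪onb H i, T (onb H i)⟫

open Classical in
/-- The principal square root `T^{1/2}` of a self-adjoint positive semi-definite operator `T`: the
self-adjoint positive semi-definite operator whose square is `T`. For compact `T`, in
particular for trace-class `T`, it exists and is unique, see `sqrtOp_spec` and `eq_sqrtOp`. -/
noncomputable def sqrtOp (T : H →L[ℝ] H) : H →L[ℝ] H :=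
  if h : ∃ S : H →L[ℝ] H, S.IsPositive ∧ S ∘L S = T then h.choose else 0

theorem sqrtOp_spec {T : H →L[ℝ] H} (hpos : T.IsPositive) (hc : IsCompactOperator T) :
    (sqrtOp T).IsPositive ∧ sqrtOp T ∘L sqrtOp T = T := by
  have h := exists_sqrt hpos hc
  rw [sqrtOp, dif_pos h]
  exact h.choose_spec

theorem eq_sqrtOp {T S : H →L[ℝ] H} (hpos : T.IsPositive) (hc : IsCompactOperator T)
    (hS : S.IsPositive) (hST : S ∘L S = T) : S = sqrtOp T :=
  sqrt_unique hpos hc hS hST (sqrtOp_spec hpos hc).1 (sqrtOp_spec hpos hc).2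

/-- The trace can be computed in any orthonormal basis. -/
theorem opTrace_eq {T : H →L[ℝ] H} (hpos : T.IsPositive) (htr : IsTraceClass T)
    {ι : Type*} (b : HilbertBasis ι ℝ H) : opTrace T = ∑' i, ⟪b i, T (b i)⟫ := by
  obtain ⟨hS, hST⟩ := sqrtOp_spec hpos htr.isCompactOperator
  have h : ∀ x, ⟪x, T x⟫ = (‖sqrtOp T x‖ₑ ^ 2).toReal := fun x => by
    have e := hS.isSymmetric x (sqrtOp T x)
    simp only [ContinuousLinearMap.coe_coe] at e
    have e2 : T x = sqrtOp T (sqrtOp T x) := by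
      conv_lhs => rw [← hST]
      rfl
    rw [e2, ← e, real_inner_self_eq_norm_sq, ENNReal.toReal_pow, toReal_enorm]
  simp_rw [opTrace, h]
  rw [← ENNReal.tsum_toReal_eq (fun i => by simp), ← ENNReal.tsum_toReal_eq (fun i => by simp),
    tsum_enorm_sq_eq (onb H) b, tsum_enorm_sq_eq b b,
    ContinuousLinearMap.adjoint_adjoint]

/-- The quasi-matrix `[f₁, …, f_n]`, that is, the operator `ξ ↦ ∑ᵢ ξᵢ fᵢ` from `ℝⁿ` to `H`. -/
noncomputable def quasiMatrix {n : ℕ} (f : Fin n → H) : EuclideanSpace ℝ (Fin n) →L[ℝ] H :=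
  ∑ i, (EuclideanSpace.proj i : EuclideanSpace ℝ (Fin n) →L[ℝ] ℝ).smulRight (f i)

/-- The orthogonal projection `P_Y` onto the range of the quasi-matrix `Y = [y₁, …, y_r]`. -/
noncomputable def rangeProj {r : ℕ} (y : Fin r → H) : H →L[ℝ] H :=
  (LinearMap.range (quasiMatrix y).toLinearMap).starProjection

/-- The Nyström approximation `T^{1/2} P_Y T^{1/2}` of `T` with sketch `Y = [y₁, …, y_r]`. -/
noncomputable def nystrom (T : H →L[ℝ] H) {r : ℕ} (y : Fin r → H) : H →L[ℝ] H :=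
  sqrtOp T ∘L rangeProj y ∘L sqrtOp T

/-- If `Y = T^{1/2} W_n Ω` and `G'` is a generalized inverse of `G = Ω^* W_n^* T W_n Ω` (such as its
Moore–Penrose pseudoinverse), then `T^{1/2} P_Y T^{1/2} = T W_n Ω G' (T W_n Ω)^*`. -/
theorem nystrom_eq {T : H →L[ℝ] H} (hpos : T.IsPositive) (htr : IsTraceClass T) {n r : ℕ}
    (w : Fin n → H) (Ω : EuclideanSpace ℝ (Fin r) →L[ℝ] EuclideanSpace ℝ (Fin n))
    (G G' : EuclideanSpace ℝ (Fin r) →L[ℝ] EuclideanSpace ℝ (Fin r))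
    (hG : G = (quasiMatrix w ∘L Ω).adjoint ∘L T ∘L quasiMatrix w ∘L Ω)
    (hG' : G ∘L G' ∘L G = G) :
    nystrom T (fun j => sqrtOp T (quasiMatrix w (Ω (EuclideanSpace.single j 1)))) =
      (T ∘L quasiMatrix w ∘L Ω) ∘L G' ∘L (T ∘L quasiMatrix w ∘L Ω).adjoint := by
  obtain ⟨hS, hST⟩ := sqrtOp_spec hpos htr.isCompactOperator
  set S := sqrtOp T with hSdef
  have hSa : S.adjoint = S := hS.isSelfAdjoint.adjoint_eq
  let X : EuclideanSpace ℝ (Fin r) →L[ℝ] H := S ∘L quasiMatrix w ∘L Ω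
  have hX : quasiMatrix (fun j => S (quasiMatrix w (Ω (EuclideanSpace.single j 1)))) = X := by
    apply ContinuousLinearMap.coe_injective
    refine (EuclideanSpace.basisFun (Fin r) ℝ).toBasis.ext fun j => ?_
    simp [quasiMatrix, X]
  have hGX : G = X.adjoint ∘L X := by
    rw [hG, ← hST]
    simp only [X, ContinuousLinearMap.adjoint_comp, hSa, ContinuousLinearMap.comp_assoc]
  have hXG : ∀ K : EuclideanSpace ℝ (Fin r) →L[ℝ] EuclideanSpace ℝ (Fin r), G ∘L K ∘L G = G →
      ∀ v, X (K (X.adjoint (X v))) = X v := by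
    intro K hK v
    have h2 : ∀ z, X.adjoint (X z) = G z := fun z => by rw [hGX]; rfl
    have h1 : X.adjoint (X (K (G v)) - X v) = 0 := by
      have := congrArg (fun F => F v) hK
      simp only [ContinuousLinearMap.comp_apply] at this
      rw [map_sub, h2, h2, this, sub_self]
    have h3 : ⟪X (K (G v)) - X v, X (K (G v)) - X v⟫ = 0 := by
      nth_rewrite 2 [← map_sub]
      rw [← ContinuousLinearMap.adjoint_inner_left, h1, inner_zero_left]
    rw [h2]
    exact sub_eq_zero.1 (inner_self_eq_zero.1 h3)
  have hGs : G.adjoint = G := by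
    rw [hGX, ContinuousLinearMap.adjoint_comp, ContinuousLinearMap.adjoint_adjoint]
  have hK' : G ∘L G'.adjoint ∘L G = G := by
    have := congrArg ContinuousLinearMap.adjoint hG'
    simpa only [ContinuousLinearMap.adjoint_comp, hGs, ContinuousLinearMap.comp_assoc] using this
  have hP : rangeProj (fun j => S (quasiMatrix w (Ω (EuclideanSpace.single j 1)))) =
      X ∘L G' ∘L X.adjoint := by
    rw [rangeProj]
    ext x
    refine Submodule.eq_starProjection_of_mem_of_inner_eq_zero ?_ ?_
    · rw [hX]
      exact ⟨_, rfl⟩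
    · rw [hX]
      rintro _ ⟨v, rfl⟩
      simp only [ContinuousLinearMap.coe_coe, ContinuousLinearMap.comp_apply, inner_sub_left]
      rw [← ContinuousLinearMap.adjoint_inner_right X, ← ContinuousLinearMap.adjoint_inner_right G',
        ← ContinuousLinearMap.adjoint_inner_right X.adjoint, ContinuousLinearMap.adjoint_adjoint,
        hXG _ hK', sub_self]
  have hTX : T ∘L quasiMatrix w ∘L Ω = S ∘L X := by
    rw [← hST]; rfl
  rw [nystrom, ← hSdef, hP, hTX]
  simp only [ContinuousLinearMap.adjoint_comp, hSa, ContinuousLinearMap.comp_assoc]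

/-- `T^{1/2} W_n W_n^* T^{1/2}`, where `W_n = [w₁, …, w_n]`. -/
noncomputable def discreteCov (T : H →L[ℝ] H) {n : ℕ} (w : Fin n → H) : H →L[ℝ] H :=
  sqrtOp T ∘L quasiMatrix w ∘L (quasiMatrix w).adjoint ∘L sqrtOp T

/-- `Tr(W_n^* T W_n)`, the trace of an endomorphism of `ℝⁿ`, where `W_n = [w₁, …, w_n]`. -/
noncomputable def compressedTrace (T : H →L[ℝ] H) {n : ℕ} (w : Fin n → H) : ℝ :=
  LinearMap.trace ℝ (EuclideanSpace ℝ (Fin n))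
    ((quasiMatrix w).adjoint ∘L T ∘L quasiMatrix w).toLinearMap

end Operators

/-! ### Gaussian measures and couplings -/

section Measures

variable {H : Type*} [NormedAddCommGroup H] [InnerProductSpace ℝ H] [CompleteSpace H]
  [MeasurableSpace H] [BorelSpace H]

/-- `μ` is the centred Gaussian measure `N_H(0, T)` with covariance operator `T`. -/
def IsCenteredGaussian (μ : Measure H) (T : H →L[ℝ] H) : Prop :=
  IsGaussian μ ∧ ∫ x, x ∂μ = 0 ∧ covarianceOperator μ = T

/-- `Γ(N_H(0, S), N_H(0, T))`: the probability measures on `H × H` whose first marginal is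
`N_H(0, S)` and whose second marginal is `N_H(0, T)`. -/
def gaussianCouplings (S T : H →L[ℝ] H) : Set (Measure (H × H)) :=
  {γ | IsProbabilityMeasure γ ∧ IsCenteredGaussian (γ.map Prod.fst) S ∧
    IsCenteredGaussian (γ.map Prod.snd) T}

/-- The infimum over all couplings `γ` of `μ_n = N_H(0, T^{1/2} W_n W_n^* T^{1/2})` and
`μ = N_H(0, T)` of `E ‖T̂ - T̂_n‖_HS`. Here the columns `(y_{n,j}, y_j)`, `j = 1, …, r`, of
`(Y_n, Y)` are independent with law `γ`, `T̂ = T^{1/2} P_Y T^{1/2}`, and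
`T̂_n = T^{1/2} P_{Y_n} T^{1/2}`. -/
noncomputable def nystromDist (T : H →L[ℝ] H) (r : ℕ) {n : ℕ} (w : Fin n → H) : ℝ≥0∞ :=
  ⨅ γ ∈ gaussianCouplings (discreteCov T w) T,
    ∫⁻ z : Fin r → H × H,
      hsNorm (nystrom T (fun j => (z j).2) - nystrom T (fun j => (z j).1))
      ∂(Measure.pi fun _ : Fin r => γ)

end Measures

end Nystrom

/-! Put S = T^{1/2}, B = S W W^* S, R = B^{1/2}, Q = 1 - W W^*, r = k + p and δ = Tr T - Tr(W^* T W)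
= ‖QS‖²_HS. Since S² - R² = (QS)^*(QS) ≥ 0, there is a bounded V with VS = R, and for y of law N(0,
T) the pair (Vy, y) is an admissible coupling (`exists_couplingOp`). Everything else estimates this
one coupling, whose error is e = Ky with K = 1 - V.

The difficulty is to reach order δ. The Powers–Størmer inequality (`hsSq_sub_le_of_inner`) gives
E‖e‖² = ‖S - R‖²_HS ≤ δ, so e is only known to have size √δ, and a plain Lipschitz bound would lose
a square root. A deterministic perturbation estimate (`hsNorm_nystrom_sub_le_of_forall_abs_le`)
shows that e enters only through s‖S e_j‖, s²|⟪y_i, e_j⟫| and s²‖e_i‖‖e_j‖, where s controls the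
inverse of the smallest singular value of Y. All three error factors are of order δ: the bound ‖S(S
- R)‖_HS ≤ 2δ (`hsSq_comp_sub_le_of_inner`) controls S e_j and, by independence, ⟪y_i, e_j⟫ for i ≠
j, while for i = j one has 2⟪y, e⟫ = ‖Qy‖² + ‖e‖² almost surely.

It remains to integrate powers of s. Given r - 1 of the columns, rank r + 2 leaves three independent
Gaussian coordinates in directions orthogonal to them, which makes the inverse distance of the last
column to their span integrable to the power 8/3
(`IsCenteredGaussian.exists_lintegral_recipDist_le`). Young's inequality with exponents 4/3 and 4
splits s²b into δ s^{8/3} + δ⁻³b⁴, and the Gaussian moments of b are controlled by Hilbert–Schmidt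
norms. The limit statement follows because partial traces over a complete orthonormal system
converge to Tr T. -/

namespace Nystrom

/-! ### Hilbert–Schmidt norms, Powers–Størmer inequalities and factorization of operators. -/

section HilbertSchmidt

universe u

variable {H : Type u} [NormedAddCommGroup H] [InnerProductSpace ℝ H] [CompleteSpace H]

/-- The squared Hilbert–Schmidt norm `∑ᵢ ‖A eᵢ‖²`. -/
noncomputable def hsSq (A : H →L[ℝ] H) : ℝ≥0∞ := ∑' i, ‖A (onb H i)‖ₑ ^ 2

theorem hsNorm_eq_hsSq_rpow (A : H →L[ℝ] H) : hsNorm A = hsSq A ^ (1 / 2 : ℝ) := rfl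

theorem hsSq_eq {ι : Type*} (b : HilbertBasis ι ℝ H) (A : H →L[ℝ] H) :
    hsSq A = ∑' i, ‖A (b i)‖ₑ ^ 2 := by
  rw [hsSq, tsum_enorm_sq_eq (onb H) b, tsum_enorm_sq_eq b b,
    ContinuousLinearMap.adjoint_adjoint]

theorem hsSq_adjoint (A : H →L[ℝ] H) : hsSq A.adjoint = hsSq A := by
  rw [hsSq, hsSq, tsum_enorm_sq_eq (onb H) (onb H), ContinuousLinearMap.adjoint_adjoint]

theorem hsSq_comp_le (A B : H →L[ℝ] H) : hsSq (A ∘L B) ≤ ‖A‖ₑ ^ 2 * hsSq B := by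
  rw [hsSq, hsSq, ← ENNReal.tsum_mul_left]
  refine ENNReal.tsum_le_tsum fun i => ?_
  rw [← mul_pow]
  exact pow_le_pow_left₀ (zero_le) (A.le_opENorm _) 2

theorem hsSq_comp_le' (A B : H →L[ℝ] H) : hsSq (A ∘L B) ≤ hsSq A * ‖B‖ₑ ^ 2 := by
  have h : ‖B.adjoint‖ₑ = ‖B‖ₑ := by
    rw [← ofReal_norm, ← ofReal_norm, LinearIsometryEquiv.norm_map]
  rw [← hsSq_adjoint, ContinuousLinearMap.adjoint_comp, mul_comm, ← h, ← hsSq_adjoint A]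
  exact hsSq_comp_le _ _

theorem hsSq_comp_adjoint_eq {S : H →L[ℝ] H} (hS : S.IsPositive) (A : H →L[ℝ] H) :
    hsSq (S ∘L A.adjoint) = hsSq (A ∘L S) := by
  rw [← hsSq_adjoint (A ∘L S), ContinuousLinearMap.adjoint_comp,
    hS.isSelfAdjoint.adjoint_eq]

theorem enorm_sub_sq_le {E : Type*} [SeminormedAddCommGroup E] (x y : E) :
    ‖x - y‖ₑ ^ 2 ≤ 2 * (‖x‖ₑ ^ 2 + ‖y‖ₑ ^ 2) := by
  have h : ‖x - y‖ ^ 2 ≤ 2 * (‖x‖ ^ 2 + ‖y‖ ^ 2) := by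
    nlinarith [norm_sub_le x y, norm_nonneg (x - y), sq_nonneg (‖x‖ - ‖y‖)]
  simp_rw [← ofReal_norm, ← ENNReal.ofReal_pow (norm_nonneg _)]
  rw [← ENNReal.ofReal_add (by positivity) (by positivity)]
  have h2 : (2 : ℝ≥0∞) = ENNReal.ofReal 2 := by simp
  rw [h2, ← ENNReal.ofReal_mul (by norm_num)]
  exact ENNReal.ofReal_le_ofReal h

theorem hsSq_sub_le (A B : H →L[ℝ] H) : hsSq (A - B) ≤ 2 * (hsSq A + hsSq B) := by
  rw [hsSq, hsSq, hsSq, ← ENNReal.tsum_add, ← ENNReal.tsum_mul_left]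
  exact ENNReal.tsum_le_tsum fun i => enorm_sub_sq_le _ _

/-- A symmetric operator with compact square is compact. -/
theorem isCompactOperator_of_comp_self {A : H →L[ℝ] H} (hA : ∀ x y, ⟪A x, y⟫ = ⟪x, A y⟫)
    (hc : IsCompactOperator (A ∘L A)) : IsCompactOperator A := by
  rw [show (⇑A : H → H) = ⇑(A : H →ₗ[ℝ] H) from rfl,
    isCompactOperator_iff_isCompact_closure_image_closedBall (A : H →ₗ[ℝ] H) one_pos]
  refine TotallyBounded.isCompact_of_isClosed (TotallyBounded.closure ?_) isClosed_closure
  have h2 : TotallyBounded ((A ∘L A) '' Metric.closedBall 0 1) :=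
    ((isCompactOperator_iff_isCompact_closure_image_closedBall
      ((A ∘L A : H →L[ℝ] H) : H →ₗ[ℝ] H) one_pos).1 hc).totallyBounded.subset subset_closure
  rw [Metric.totallyBounded_iff] at h2 ⊢
  intro ε hε
  -- On the unit ball ‖A(x - x')‖² = ⟪x - x', A²(x - x')⟫ ≤ 2‖A²x - A²x'‖, so an ε²/2-net for the
  -- image under A² pulls back to an ε-net for the image under A.
  obtain ⟨t, htsub, htf, ht⟩ := Metric.finite_approx_of_totallyBounded
    (Metric.totallyBounded_iff.2 h2) (ε ^ 2 / 2) (by positivity)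
  have htsub' : ∀ y ∈ t, ∃ x ∈ Metric.closedBall 0 1, (A ∘L A) x = y := htsub
  choose! g hg hg' using htsub'
  refine ⟨(fun y => A (g y)) '' t, htf.image _, ?_⟩
  rintro _ ⟨x, hx, rfl⟩
  have := ht ⟨x, hx, rfl⟩
  simp only [Set.mem_iUnion, Set.mem_image, exists_prop] at this ⊢
  obtain ⟨y, hy, hxy⟩ := this
  refine ⟨A (g y), ⟨y, hy, rfl⟩, ?_⟩
  have hgy := hg y hy
  have e := hg' y hy
  rw [Metric.mem_ball, dist_eq_norm] at hxy ⊢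
  rw [mem_closedBall_zero_iff] at hx hgy
  simp only [ContinuousLinearMap.coe_coe, ContinuousLinearMap.comp_apply] at hxy e ⊢
  rw [← e, ← map_sub, ← map_sub] at hxy
  rw [← map_sub]
  refine lt_of_pow_lt_pow_left₀ 2 hε.le ?_
  rw [← real_inner_self_eq_norm_sq, hA]
  have h3 : ‖x - g y‖ ≤ 2 := (norm_sub_le _ _).trans (by linarith)
  calc ⟪x - g y, A (A (x - g y))⟫ ≤ ‖x - g y‖ * ‖A (A (x - g y))‖ := real_inner_le_norm _ _
    _ ≤ 2 * ‖A (A (x - g y))‖ := by gcongr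
    _ < ε ^ 2 := by linarith

/-- The eigenspaces are mutually orthogonal with dense sum, so orthonormal bases of them can be
glued. Positivity is not assumed because this is applied to S - R, whose sign is not known
beforehand. -/
theorem exists_eigenbasis_of_symmetric {T : H →L[ℝ] H} (hsym : (T : H →ₗ[ℝ] H).IsSymmetric)
    (hc : IsCompactOperator T) :
    ∃ (ι : Type u) (b : HilbertBasis ι ℝ H) (l : ι → ℝ), ∀ i, T (b i) = l i • b i := by
  let G : ℝ → Submodule ℝ H := fun c => Module.End.eigenspace (T : Module.End ℝ H) c
  have hGc : ∀ c, CompleteSpace (G c) := fun c => by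
    have : IsClosed (G c : Set H) := by
      have : (G c : Set H) = {x | T x = c • x} := by
        ext x; simp [G]
      rw [this]
      exact isClosed_eq T.continuous (continuous_const_smul c)
    exact this.completeSpace_coe
  choose K e _ using fun c => exists_hilbertBasis ℝ (G c)
  have ho : OrthogonalFamily ℝ (fun c => G c) fun c => (G c).subtypeₗᵢ :=
    hsym.orthogonalFamily_eigenspaces
  have hon := ho.orthonormal_sigma_orthonormal (v_family := fun c => (e c : _ → G c))
    fun c => (e c).orthonormal
  have hbot : (Submodule.span ℝ (Set.range fun a : Σ c, K c =>
      (G a.1).subtypeₗᵢ (e a.1 a.2)))ᗮ = ⊥ := by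
    rw [eq_bot_iff, ← ContinuousLinearMap.orthogonalComplement_iSup_eigenspaces_eq_bot hc hsym]
    intro x hx
    rw [Submodule.mem_orthogonal] at hx ⊢
    have hx2 : ∀ c, G c ≤ LinearMap.ker (innerSL ℝ x).toLinearMap := by
      intro c y hy
      have hsub : (Submodule.span ℝ (Set.range (e c))).topologicalClosure ≤
          LinearMap.ker ((innerSL ℝ x) ∘L (G c).subtypeL).toLinearMap := by
        apply Submodule.topologicalClosure_minimal
        · rw [Submodule.span_le]
          rintro _ ⟨i, rfl⟩
          have := hx _ (Submodule.subset_span ⟨⟨c, i⟩, rfl⟩)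
          simpa [real_inner_comm] using this
        · exact ContinuousLinearMap.isClosed_ker ((innerSL ℝ x) ∘L (G c).subtypeL)
      have := hsub (x := ⟨y, hy⟩) (by rw [(e c).dense_span]; trivial)
      simpa using this
    intro z hz
    have := (iSup_le hx2) hz
    simpa [real_inner_comm] using this
  let b := HilbertBasis.mkOfOrthogonalEqBot hon hbot
  refine ⟨_, b, fun i => i.1, fun i => ?_⟩
  have h1 : b i = (e i.1 i.2 : G i.1) := by simp [b]
  rw [h1]
  exact Module.End.mem_eigenspace_iff.1 (e i.1 i.2).2

/-- A quantitative form of the monotonicity of the square root, in an eigenbasis of `S - R`. -/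
theorem exists_eigenbasis_sub {S R A : H →L[ℝ] H} (hS : S.IsPositive) (hR : R.IsPositive)
    (hSc : IsCompactOperator S) (hRc : IsCompactOperator R)
    (hA : ∀ x y, ⟪S x, S y⟫ - ⟪R x, R y⟫ = ⟪A x, A y⟫) :
    ∃ (ι : Type u) (b : HilbertBasis ι ℝ H) (d : ι → ℝ), (∀ i, (S - R) (b i) = d i • b i) ∧
      (∀ i, 0 ≤ d i) ∧ (∀ i, d i ^ 2 ≤ ‖A (b i)‖ ^ 2) := by
  have hsym : ((S - R : H →L[ℝ] H) : H →ₗ[ℝ] H).IsSymmetric := by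
    have := hS.isSymmetric.sub hR.isSymmetric
    simpa using this
  obtain ⟨ι, b, d, hb⟩ := exists_eigenbasis_of_symmetric hsym (hSc.sub hRc)
  have hRb : ∀ i, R (b i) = S (b i) - d i • b i := fun i => by
    rw [← hb i]; simp
  -- Substitute R b = S b - d b. The identity rules out d < 0 because ⟪b, S b⟫ ≥ 0; positivity of R
  -- gives d ≤ ⟪b, S b⟫, and then the right side is at least 2d² - d² = d².
  have key : ∀ i, ‖A (b i)‖ ^ 2 = 2 * d i * ⟪b i, S (b i)⟫ - d i ^ 2 ∧ 0 ≤ ⟪b i, S (b i)⟫ ∧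
      d i ≤ ⟪b i, S (b i)⟫ := fun i => by
    have h1 := hA (b i) (b i)
    have h2 := hS.inner_nonneg_right (b i)
    have h3 := hR.inner_nonneg_right (b i)
    rw [hRb i, inner_sub_right, inner_smul_right, real_inner_self_eq_norm_sq,
      b.orthonormal.1 i] at h3
    rw [hRb i, real_inner_self_eq_norm_sq (A (b i)), inner_sub_left, inner_sub_right,
      inner_sub_right, inner_smul_right, inner_smul_left, inner_smul_left, inner_smul_right,
      real_inner_self_eq_norm_sq (b i), b.orthonormal.1 i, real_inner_comm (b i) (S (b i))] at h1
    simp only [conj_trivial] at h1 h3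
    refine ⟨by linarith, h2, by linarith⟩
  have hd : ∀ i, 0 ≤ d i := fun i => by
    obtain ⟨h1, h2, _⟩ := key i
    by_contra hlt
    push Not at hlt
    nlinarith [sq_nonneg ‖A (b i)‖, mul_nonneg (neg_nonneg.2 hlt.le) h2]
  refine ⟨ι, b, d, hb, hd, fun i => ?_⟩
  obtain ⟨h1, h2, h3⟩ := key i
  nlinarith [mul_le_mul_of_nonneg_left h3 (hd i)]

/-- The Powers–Størmer inequality for `R² ≤ S²`. -/
theorem hsSq_sub_le_of_inner {S R A : H →L[ℝ] H} (hS : S.IsPositive) (hR : R.IsPositive)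
    (hSc : IsCompactOperator S) (hRc : IsCompactOperator R)
    (hA : ∀ x y, ⟪S x, S y⟫ - ⟪R x, R y⟫ = ⟪A x, A y⟫) : hsSq (S - R) ≤ hsSq A := by
  obtain ⟨ι, b, d, hb, hd, hdA⟩ := exists_eigenbasis_sub hS hR hSc hRc hA
  rw [hsSq_eq b, hsSq_eq b]
  refine ENNReal.tsum_le_tsum fun i => ?_
  refine pow_le_pow_left₀ (zero_le) ?_ 2
  rw [← ofReal_norm, ← ofReal_norm, hb i, norm_smul, b.orthonormal.1 i, mul_one]
  exact ENNReal.ofReal_le_ofReal (abs_le_of_sq_le_sq (hdA i) (norm_nonneg _))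

/-- With D = S - R one has SD + DS = A^*A + D². In an eigenbasis of D this reads (d_i + d_j)⟪b_i, S
b_j⟫ = ⟪A b_i, A b_j⟫ + ⟪D b_i, D b_j⟫, and since d ≥ 0 it bounds every matrix entry of SD. This
quadratic gain over ‖D‖²_HS ≤ ‖A‖²_HS is what makes the final rate linear. -/
theorem hsSq_comp_sub_le_of_inner {S R A : H →L[ℝ] H} (hS : S.IsPositive) (hR : R.IsPositive)
    (hSc : IsCompactOperator S) (hRc : IsCompactOperator R)
    (hA : ∀ x y, ⟪S x, S y⟫ - ⟪R x, R y⟫ = ⟪A x, A y⟫) :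
    hsSq (S ∘L (S - R)) ≤ 4 * hsSq A ^ 2 := by
  have hDA := hsSq_sub_le_of_inner hS hR hSc hRc hA
  obtain ⟨ι, b, d, hb, hd, hdA⟩ := exists_eigenbasis_sub hS hR hSc hRc hA
  have hRb : ∀ i, R (b i) = S (b i) - d i • b i := fun i => by
    rw [← hb i]; simp
  have key : ∀ i j, d j * |⟪b i, S (b j)⟫| ≤
      ‖A (b i)‖ * ‖A (b j)‖ + ‖(S - R) (b i)‖ * ‖(S - R) (b j)‖ := fun i j => by
    have h1 := hA (b i) (b j)
    have h2 : ⟪S (b i), b j⟫ = ⟪b i, S (b j)⟫ := hS.isSymmetric (b i) (b j)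
    have h3 : (d i + d j) * ⟪b i, S (b j)⟫ =
        ⟪A (b i), A (b j)⟫ + ⟪(S - R) (b i), (S - R) (b j)⟫ := by
      rw [← h1, hRb, hRb, hb, hb]
      simp only [inner_sub_left, inner_sub_right, inner_smul_left, inner_smul_right,
        conj_trivial, h2]
      ring
    calc d j * |⟪b i, S (b j)⟫| ≤ (d i + d j) * |⟪b i, S (b j)⟫| := by
          gcongr
          linarith [hd i]
      _ = |⟪A (b i), A (b j)⟫ + ⟪(S - R) (b i), (S - R) (b j)⟫| := by
          rw [← h3, abs_mul, abs_of_nonneg (add_nonneg (hd i) (hd j))]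
      _ ≤ _ := (abs_add_le _ _).trans
          (add_le_add (abs_real_inner_le_norm _ _) (abs_real_inner_le_norm _ _))
  have key2 : ∀ i j, ‖⟪b i, (S ∘L (S - R)) (b j)⟫‖ₑ ^ 2 ≤
      2 * (‖A (b i)‖ₑ ^ 2 * ‖A (b j)‖ₑ ^ 2 + ‖(S - R) (b i)‖ₑ ^ 2 * ‖(S - R) (b j)‖ₑ ^ 2) := by
    intro i j
    have e1 : ‖⟪b i, (S ∘L (S - R)) (b j)⟫‖ = d j * |⟪b i, S (b j)⟫| := by
      rw [ContinuousLinearMap.comp_apply, hb, map_smul, inner_smul_right, Real.norm_eq_abs,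
        abs_mul, abs_of_nonneg (hd j)]
    have h : ‖⟪b i, (S ∘L (S - R)) (b j)⟫‖ ^ 2 ≤ 2 * (‖A (b i)‖ ^ 2 * ‖A (b j)‖ ^ 2 +
        ‖(S - R) (b i)‖ ^ 2 * ‖(S - R) (b j)‖ ^ 2) := by
      rw [e1]
      have h0 : 0 ≤ d j * |⟪b i, S (b j)⟫| := mul_nonneg (hd j) (abs_nonneg _)
      refine (pow_le_pow_left₀ h0 (key i j) 2).trans ?_
      nlinarith [sq_nonneg (‖A (b i)‖ * ‖A (b j)‖ - ‖(S - R) (b i)‖ * ‖(S - R) (b j)‖)]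
    simp_rw [← ofReal_norm, ← ENNReal.ofReal_pow (norm_nonneg _)]
    rw [← ENNReal.ofReal_mul (by positivity), ← ENNReal.ofReal_mul (by positivity),
      ← ENNReal.ofReal_add (by positivity) (by positivity)]
    have h2 : (2 : ℝ≥0∞) = ENNReal.ofReal 2 := by simp
    rw [h2, ← ENNReal.ofReal_mul (by norm_num)]
    exact ENNReal.ofReal_le_ofReal h
  calc hsSq (S ∘L (S - R)) = ∑' j, ∑' i, ‖⟪b i, (S ∘L (S - R)) (b j)⟫‖ₑ ^ 2 := by
        rw [hsSq_eq b]
        exact tsum_congr fun j => enorm_sq_eq b _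
    _ ≤ ∑' j, ∑' i, 2 * (‖A (b i)‖ₑ ^ 2 * ‖A (b j)‖ₑ ^ 2 +
          ‖(S - R) (b i)‖ₑ ^ 2 * ‖(S - R) (b j)‖ₑ ^ 2) :=
        ENNReal.tsum_le_tsum fun j => ENNReal.tsum_le_tsum fun i => key2 i j
    _ = 2 * (hsSq A ^ 2 + hsSq (S - R) ^ 2) := by
        simp_rw [ENNReal.tsum_mul_left, ENNReal.tsum_add, ENNReal.tsum_mul_right,
          ENNReal.tsum_mul_left, ← hsSq_eq b]
        rw [sq, sq]
    _ ≤ 2 * (hsSq A ^ 2 + hsSq A ^ 2) := by gcongr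
    _ = 4 * hsSq A ^ 2 := by ring

/-- If `‖R x‖ ≤ ‖S x‖` for all `x`, then `R` factors through `S`. -/
theorem exists_comp_eq_of_norm_le {S R : H →L[ℝ] H} (h : ∀ x, ‖R x‖ ≤ ‖S x‖) :
    ∃ V : H →L[ℝ] H, V ∘L S = R := by
  let N := (LinearMap.range S.toLinearMap).topologicalClosure
  have hN : CompleteSpace N := (Submodule.isClosed_topologicalClosure _).completeSpace_coe
  let e : H →L[ℝ] N := S.codRestrict N fun x =>
    Submodule.le_topologicalClosure _ (LinearMap.mem_range_self S.toLinearMap x)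
  have he : DenseRange e := by
    intro y
    rw [closure_subtype]
    have : (Subtype.val '' Set.range e : Set H) = LinearMap.range S.toLinearMap := by
      ext z; simp [e]
    rw [this]
    exact y.2
  have hn : ∀ x, ‖R x‖ ≤ 1 * ‖e x‖ := fun x => by
    simpa [e] using h x
  -- The map S x ↦ R x extends by continuity to the closure of the range of S; the projection in
  -- front makes V vanish on the orthogonal complement.
  refine ⟨(R.toLinearMap.extendOfNorm e.toLinearMap) ∘L N.orthogonalProjectionOnto, ?_⟩
  ext x
  have hx : N.orthogonalProjectionOnto (S x) = e x :=
    Submodule.orthogonalProjectionOnto_mem_subspace_eq_self (e x)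
  simp only [ContinuousLinearMap.comp_apply, hx]
  exact LinearMap.extendOfNorm_eq (f := R.toLinearMap) (e := e.toLinearMap) he ⟨1, hn⟩ x

end HilbertSchmidt

/-! ### Finiteness of the trace and the square root of a trace-class operator. -/

section TraceClass

universe u

variable {H : Type u} [NormedAddCommGroup H] [InnerProductSpace ℝ H]

theorem enorm_sq_eq_ofReal {E : Type*} [SeminormedAddGroup E] (x : E) :
    ‖x‖ₑ ^ 2 = ENNReal.ofReal (‖x‖ ^ 2) := by
  rw [ENNReal.ofReal_pow (norm_nonneg _), ofReal_norm]

theorem tsum_enorm_inner_sq_le {ι κ : Type*} {u : κ → H} (hu : Orthonormal ℝ u)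
    (b : HilbertBasis ι ℝ H) (k : κ) : ∑' i, ‖⟪b i, u k⟫‖ₑ ^ 2 = 1 := by
  rw [← enorm_sq_eq b, enorm_sq_eq_ofReal, hu.1 k]
  simp

/-- Expand in singular vectors: |⟪v_k, b_i⟫⟪b_i, u_k⟫| is at most the sum of the two squares, and
Parseval in i leaves 2 ∑ σ_k. -/
theorem IsTraceClass.tsum_ofReal_inner_ne_top {T : H →L[ℝ] H} (htr : IsTraceClass T)
    {ι : Type*} (b : HilbertBasis ι ℝ H) : ∑' i, ENNReal.ofReal ⟪b i, T (b i)⟫ ≠ ∞ := by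
  obtain ⟨κ, u, v, σ, hu, hv, h0, hs, h⟩ := htr
  have h1 : ∀ i, ENNReal.ofReal ⟪b i, T (b i)⟫ ≤
      ∑' k, ENNReal.ofReal (σ k) * (‖⟪b i, v k⟫‖ₑ ^ 2 + ‖⟪b i, u k⟫‖ₑ ^ 2) := fun i => by
    have h2 : HasSum (fun k => σ k * ⟪v k, b i⟫ * ⟪b i, u k⟫) ⟪b i, T (b i)⟫ := by
      have := (h (b i)).mapL (innerSL ℝ (b i))
      simpa [inner_smul_right] using this
    rw [← h2.tsum_eq]
    refine (ENNReal.ofReal_le_ofReal (le_abs_self _)).trans ?_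
    rw [← Real.norm_eq_abs, ofReal_norm]
    refine (enorm_tsum_le_tsum_enorm).trans (ENNReal.tsum_le_tsum fun k => ?_)
    rw [enorm_sq_eq_ofReal, enorm_sq_eq_ofReal, ← ENNReal.ofReal_add (by positivity)
      (by positivity), ← ENNReal.ofReal_mul (h0 k), ← ofReal_norm]
    refine ENNReal.ofReal_le_ofReal ?_
    rw [norm_mul, norm_mul, Real.norm_of_nonneg (h0 k), mul_assoc, real_inner_comm (b i) (v k)]
    refine mul_le_mul_of_nonneg_left ?_ (h0 k)
    nlinarith [sq_nonneg (‖⟪b i, v k⟫‖ - ‖⟪b i, u k⟫‖), norm_nonneg ⟪b i, v k⟫,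
      norm_nonneg ⟪b i, u k⟫]
  refine ne_top_of_le_ne_top ?_ (ENNReal.tsum_le_tsum h1)
  rw [ENNReal.tsum_comm]
  simp_rw [ENNReal.tsum_mul_left, ENNReal.tsum_add, tsum_enorm_inner_sq_le hu b,
    tsum_enorm_inner_sq_le hv b, ENNReal.tsum_mul_right]
  refine ENNReal.mul_ne_top ?_ (by norm_num)
  rw [← ENNReal.ofReal_tsum_of_nonneg h0 hs]
  exact ENNReal.ofReal_ne_top

variable [CompleteSpace H]

theorem inner_sqrtOp_sqrtOp {T : H →L[ℝ] H} (hpos : T.IsPositive) (hc : IsCompactOperator T)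
    (x y : H) : ⟪sqrtOp T x, sqrtOp T y⟫ = ⟪x, T y⟫ := by
  obtain ⟨hS, hST⟩ := sqrtOp_spec hpos hc
  have e := hS.isSymmetric x (sqrtOp T y)
  simp only [ContinuousLinearMap.coe_coe] at e
  rw [e, ← ContinuousLinearMap.comp_apply, hST]

theorem sqrtOp_sqrtOp_apply {T : H →L[ℝ] H} (hpos : T.IsPositive) (hc : IsCompactOperator T)
    (x : H) : sqrtOp T (sqrtOp T x) = T x := by
  rw [← ContinuousLinearMap.comp_apply, (sqrtOp_spec hpos hc).2]

theorem ofReal_inner_eq {T : H →L[ℝ] H} (hpos : T.IsPositive) (hc : IsCompactOperator T)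
    (x : H) : ENNReal.ofReal ⟪x, T x⟫ = ‖sqrtOp T x‖ₑ ^ 2 := by
  rw [← inner_sqrtOp_sqrtOp hpos hc, real_inner_self_eq_norm_sq, enorm_sq_eq_ofReal]

theorem isCompactOperator_sqrtOp {T : H →L[ℝ] H} (hpos : T.IsPositive)
    (hc : IsCompactOperator T) : IsCompactOperator (sqrtOp T) := by
  obtain ⟨hS, hST⟩ := sqrtOp_spec hpos hc
  exact isCompactOperator_of_comp_self (fun x y => hS.isSymmetric x y) (by rwa [hST])

theorem hsSq_sqrtOp_ne_top {T : H →L[ℝ] H} (hpos : T.IsPositive) (htr : IsTraceClass T) :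
    hsSq (sqrtOp T) ≠ ∞ := by
  simp_rw [hsSq, ← ofReal_inner_eq hpos htr.isCompactOperator]
  exact htr.tsum_ofReal_inner_ne_top _

theorem hsSq_sqrtOp {T : H →L[ℝ] H} (hpos : T.IsPositive) (htr : IsTraceClass T) :
    hsSq (sqrtOp T) = ENNReal.ofReal (opTrace T) := by
  have h : ∀ i, 0 ≤ ⟪onb H i, T (onb H i)⟫ := fun i => hpos.inner_nonneg_right _
  have h2 := htr.tsum_ofReal_inner_ne_top (onb H)
  have hs : Summable fun i => ⟪onb H i, T (onb H i)⟫ :=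
    (ENNReal.summable_toReal h2).congr fun i => ENNReal.toReal_ofReal (h i)
  rw [opTrace, ENNReal.ofReal_tsum_of_nonneg h hs]
  simp_rw [ofReal_inner_eq hpos htr.isCompactOperator]
  rfl

end TraceClass

/-! ### Existence of N(0, T) for trace-class T. -/

section GaussianExistence

universe u

variable {H : Type u} [NormedAddCommGroup H] [InnerProductSpace ℝ H]
  [SecondCountableTopology H]

theorem countable_of_hilbertBasis {ι : Type*} (b : HilbertBasis ι ℝ H) : Countable ι := by
  rw [← Set.countable_univ_iff]
  refine Set.PairwiseDisjoint.countable_of_isOpen (s := fun i => Metric.ball (b i) (1 / 2)) ?_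
    (fun i _ => Metric.isOpen_ball) (fun i _ => ⟨b i, Metric.mem_ball_self (by norm_num)⟩)
  intro i _ j _ hij
  refine Metric.ball_disjoint_ball ?_
  rw [dist_eq_norm]
  refine le_of_pow_le_pow_left₀ two_ne_zero (norm_nonneg _) ?_
  rw [@norm_sub_sq_real, b.orthonormal.1, b.orthonormal.1, b.orthonormal.2 hij]
  norm_num

variable [MeasurableSpace H] [BorelSpace H]

/-- The law of a Gaussian series `∑ᵢ √lᵢ ξᵢ bᵢ`, via its characteristic function. -/
theorem exists_charFun_eq {ι : Type*} (b : HilbertBasis ι ℝ H) {l : ι → ℝ} (hl : ∀ i, 0 ≤ l i)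
    (hs : Summable l) : ∃ μ : Measure H, IsProbabilityMeasure μ ∧
      ∀ t, charFun μ t = Complex.exp (-((∑' i, l i * ⟪b i, t⟫ ^ 2 : ℝ) : ℂ) / 2) := by
  have : Countable ι := countable_of_hilbertBasis b
  let P : Measure (ι → ℝ) := Measure.infinitePi fun _ => gaussianReal 0 1
  have hP : IsProbabilityMeasure P := by infer_instance
  -- The expectation of this series is ∑ l_i, which is finite; hence the random coefficients are
  -- almost surely square summable and the Gaussian series converges in H.
  have hsq : ∀ᵐ ω ∂P, Summable fun i => l i * ω i ^ 2 := by
    have h1 : ∀ i, ∫⁻ ω, ENNReal.ofReal (l i * ω i ^ 2) ∂P = ENNReal.ofReal (l i) := fun i => by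
      have hmp := measurePreserving_eval_infinitePi (fun _ : ι => gaussianReal 0 1) i
      rw [hmp.lintegral_comp (f := fun x : ℝ => ENNReal.ofReal (l i * x ^ 2)) (by fun_prop),
        ← ofReal_integral_eq_lintegral_ofReal]
      · have hv := variance_fun_id_gaussianReal (μ := 0) (v := 1)
        rw [variance_of_integral_eq_zero (by fun_prop) integral_id_gaussianReal] at hv
        rw [integral_const_mul, hv]
        simp
      · exact (memLp_id_gaussianReal 2).integrable_sq.const_mul _
      · exact .of_forall fun x => mul_nonneg (hl i) (sq_nonneg x)
    have hm : ∀ i, Measurable fun ω : ι → ℝ => ENNReal.ofReal (l i * ω i ^ 2) := fun i => by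
      fun_prop
    have h2 : ∫⁻ ω, ∑' i, ENNReal.ofReal (l i * ω i ^ 2) ∂P ≠ ∞ := by
      rw [lintegral_tsum (fun i => (hm i).aemeasurable)]
      simp_rw [h1]
      rw [← ENNReal.ofReal_tsum_of_nonneg hl hs]
      exact ENNReal.ofReal_ne_top
    filter_upwards [ae_lt_top (Measurable.tsum hm) h2] with ω hω
    exact (ENNReal.summable_toReal hω.ne).congr fun i =>
      ENNReal.toReal_ofReal (mul_nonneg (hl i) (sq_nonneg _))
  let X : Finset ι → (ι → ℝ) → H := fun s ω => ∑ i ∈ s, (√(l i) * ω i) • b i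
  let Y : (ι → ℝ) → H := fun ω => ∑' i, (√(l i) * ω i) • b i
  have hXY : ∀ᵐ ω ∂P, Tendsto (fun s => X s ω) atTop (𝓝 (Y ω)) := by
    filter_upwards [hsq] with ω hω
    have h3 : Memℓp (fun i => √(l i) * ω i) 2 := by
      refine memℓp_gen (hω.congr fun i => ?_)
      simp [mul_pow, Real.sq_sqrt (hl i)]
    exact (b.hasSum_repr_symm ⟨_, h3⟩).summable.hasSum
  have hXm : ∀ s, Measurable (X s) := fun s => by fun_prop
  have hYm : AEMeasurable Y P :=
    aemeasurable_of_tendsto_metrizable_ae _ (fun s => (hXm s).aemeasurable) hXY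
  refine ⟨P.map Y, Measure.isProbabilityMeasure_map hYm, fun t => ?_⟩
  rw [charFun_apply, integral_map hYm (by fun_prop)]
  have hl2 : Summable fun i => l i * ⟪b i, t⟫ ^ 2 := by
    refine Summable.of_nonneg_of_le (fun i => mul_nonneg (hl i) (sq_nonneg _)) (fun i => ?_)
      (hs.mul_right (‖t‖ ^ 2))
    refine mul_le_mul_of_nonneg_left ?_ (hl i)
    rw [← sq_abs]
    refine pow_le_pow_left₀ (abs_nonneg _) ?_ 2
    simpa [b.orthonormal.1 i] using abs_real_inner_le_norm (b i) t
  have hfin : ∀ s, ∫ ω, Complex.exp (⟪X s ω, t⟫ * Complex.I) ∂P =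
      Complex.exp (-((∑ i ∈ s, l i * ⟪b i, t⟫ ^ 2 : ℝ) : ℂ) / 2) := fun s => by
    let F : (s → ℝ) → ℂ := fun y =>
      ∏ i : s, Complex.exp (((√(l i) * ⟪b i, t⟫ : ℝ) : ℂ) * (y i : ℂ) * Complex.I)
    have h4 : ∀ ω, Complex.exp (⟪X s ω, t⟫ * Complex.I) = F (s.restrict ω) := fun ω => by
      simp only [F]
      rw [← Complex.exp_sum, ← Finset.sum_mul]
      congr 2
      simp only [X, sum_inner, inner_smul_left, conj_trivial, Finset.restrict]
      push_cast
      rw [← Finset.sum_coe_sort s]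
      refine Finset.sum_congr rfl fun i _ => by ring
    simp_rw [h4]
    refine (integral_restrict_infinitePi (μ := fun _ : ι => gaussianReal 0 1) (f := F)
      (by fun_prop)).trans ?_
    rw [integral_fintype_prod_eq_prod
      (f := fun (i : s) (x : ℝ) => Complex.exp
        (((√(l i) * ⟪b i, t⟫ : ℝ) : ℂ) * (x : ℂ) * Complex.I))]
    simp_rw [← charFun_apply_real, charFun_gaussianReal]
    rw [← Complex.exp_sum, ← Finset.sum_coe_sort s, Complex.ofReal_sum, ← Finset.sum_neg_distrib,
      Finset.sum_div]
    congr 1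
    refine Finset.sum_congr rfl fun i _ => ?_
    rw [← Complex.ofReal_pow, mul_pow, Real.sq_sqrt (hl i)]
    simp
    ring
  -- Finite partial sums have explicit characteristic functions by independence; the exponentials
  -- have modulus one, so dominated convergence passes to the full series.
  have hlim1 : Tendsto (fun s => ∫ ω, Complex.exp (⟪X s ω, t⟫ * Complex.I) ∂P) atTop
      (𝓝 (∫ ω, Complex.exp (⟪Y ω, t⟫ * Complex.I) ∂P)) := by
    refine tendsto_integral_filter_of_dominated_convergence (fun _ => 1)
      (.of_forall fun s => by fun_prop) (.of_forall fun s => .of_forall fun ω => ?_)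
      (integrable_const _) ?_
    · rw [Complex.norm_exp_ofReal_mul_I]
    · filter_upwards [hXY] with ω hω
      have hc : Continuous fun x : H => Complex.exp (⟪x, t⟫ * Complex.I) := by fun_prop
      exact (hc.tendsto _).comp hω
  refine tendsto_nhds_unique hlim1 ?_
  simp_rw [hfin]
  have hc : Continuous fun x : ℝ => Complex.exp (-(x : ℂ) / 2) := by fun_prop
  exact (hc.tendsto _).comp hl2.hasSum

variable [CompleteSpace H]

/-- For an eigenbasis the characteristic function of the Gaussian series is exp(-⟪T t, t⟫ / 2),
which identifies the measure as Gaussian and determines its mean and covariance. -/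
theorem exists_isCenteredGaussian {T : H →L[ℝ] H} (hpos : T.IsPositive) (htr : IsTraceClass T) :
    ∃ μ : Measure H, IsCenteredGaussian μ T := by
  obtain ⟨ι, b, l, hl, hb⟩ := exists_eigenbasis hpos htr.isCompactOperator
  have hTb : ∀ i, ⟪b i, T (b i)⟫ = l i := fun i => by
    rw [hb, inner_smul_right, real_inner_self_eq_norm_sq, b.orthonormal.1]; simp
  have hs : Summable l := by
    refine (ENNReal.summable_toReal (htr.tsum_ofReal_inner_ne_top b)).congr fun i => ?_
    rw [hTb, ENNReal.toReal_ofReal (hl i)]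
  obtain ⟨μ, hμ, hch⟩ := exists_charFun_eq b hl hs
  have hsym : ∀ x y, ⟪T x, y⟫ = ⟪x, T y⟫ := fun x y => hpos.isSymmetric x y
  let f : H →L[ℝ] H →L[ℝ] ℝ := (innerSL ℝ : H →L[ℝ] H →L[ℝ] ℝ) ∘L T
  have hf : ∀ x y, f x y = ⟪T x, y⟫ := fun x y => rfl
  have hfp : f.toBilinForm.IsPosSemidef :=
    ⟨⟨fun x y => by
      change f x y = f y x
      rw [hf, hf, hsym, real_inner_comm]⟩, ⟨fun x => hpos.inner_nonneg_left x⟩⟩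
  have hch2 : ∀ t, charFun μ t = Complex.exp (⟪t, (0 : H)⟫ * Complex.I - f t t / 2) := fun t => by
    have h1 : (∑' i, l i * ⟪b i, t⟫ ^ 2) = ⟪T t, t⟫ := by
      rw [← b.tsum_inner_mul_inner]
      refine tsum_congr fun i => ?_
      rw [hsym, hb, inner_smul_right, real_inner_comm t (b i)]
      ring
    rw [hch, h1, hf]
    simp [neg_div]
  have hG : IsGaussian μ := isGaussian_iff_gaussian_charFun.2 ⟨0, f, hfp, hch2⟩
  obtain ⟨h0, hcov⟩ := gaussian_charFun_congr 0 f hfp hch2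
  refine ⟨μ, hG, h0.symm, ?_⟩
  ext x
  refine ext_inner_right ℝ fun y => ?_
  rw [covarianceOperator_inner IsGaussian.memLp_two_id, ← hf, hcov,
    covarianceBilin_apply IsGaussian.memLp_two_id]
  simp [← h0]

end GaussianExistence

/-! ### Moments of Gaussian vectors. -/

section Moments

/-- Minkowski's inequality for infinite sums, in terms of `p`-th powers. -/
theorem lintegral_add_pow_le {α : Type*} [MeasurableSpace α] {μ : Measure α} {u v : α → ℝ≥0∞}
    (hu : Measurable u) (hv : Measurable v) {p : ℕ} (hp : p ≠ 0) {m a b : ℝ≥0∞}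
    (hua : ∫⁻ x, u x ^ p ∂μ ≤ m * a ^ p) (hvb : ∫⁻ x, v x ^ p ∂μ ≤ m * b ^ p) :
    ∫⁻ x, (u x + v x) ^ p ∂μ ≤ m * (a + b) ^ p := by
  have hp1 : (1 : ℝ) ≤ p := by exact_mod_cast Nat.one_le_iff_ne_zero.2 hp
  have hp0 : (p : ℝ) ≠ 0 := by positivity
  have key : ∀ {f : α → ℝ≥0∞} {c : ℝ≥0∞}, ∫⁻ x, f x ^ p ∂μ ≤ m * c ^ p →
      (∫⁻ x, f x ^ (p : ℝ) ∂μ) ^ (1 / (p : ℝ)) ≤ m ^ (1 / (p : ℝ)) * c := by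
    intro f c h
    simp_rw [ENNReal.rpow_natCast]
    refine (ENNReal.rpow_le_rpow h (by positivity)).trans_eq ?_
    rw [ENNReal.mul_rpow_of_nonneg _ _ (by positivity), ← ENNReal.rpow_natCast,
      ← ENNReal.rpow_mul, mul_one_div_cancel hp0, ENNReal.rpow_one]
  have h := ENNReal.lintegral_Lp_add_le hu.aemeasurable hv.aemeasurable (μ := μ) hp1
  have h2 := h.trans (add_le_add (key hua) (key hvb))
  rw [← mul_add] at h2
  have h3 := ENNReal.rpow_le_rpow h2 (by positivity : (0 : ℝ) ≤ p)
  rw [ENNReal.mul_rpow_of_nonneg _ _ (by positivity), ← ENNReal.rpow_mul, ← ENNReal.rpow_mul,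
    one_div_mul_cancel hp0, ENNReal.rpow_one, ENNReal.rpow_one] at h3
  simpa using h3

/-- Minkowski on finite subsums, then monotone convergence. Applied to ‖A y‖² = ∑ ⟪e_i, A y⟫², it
bounds high moments without any independence of the coordinates. -/
theorem lintegral_tsum_pow_le {α ι : Type*} [Countable ι] [MeasurableSpace α] {μ : Measure α}
    {g : ι → α → ℝ≥0∞} (hg : ∀ i, Measurable (g i)) {p : ℕ} (hp : p ≠ 0) {m : ℝ≥0∞}
    {a : ι → ℝ≥0∞} (h : ∀ i, ∫⁻ x, g i x ^ p ∂μ ≤ m * a i ^ p) :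
    ∫⁻ x, (∑' i, g i x) ^ p ∂μ ≤ m * (∑' i, a i) ^ p := by
  classical
  have hfin : ∀ s : Finset ι, ∫⁻ x, (∑ i ∈ s, g i x) ^ p ∂μ ≤ m * (∑ i ∈ s, a i) ^ p := by
    intro s
    induction s using Finset.induction_on with
    | empty => simp [hp]
    | insert i s hi ih =>
      simp_rw [Finset.sum_insert hi]
      exact lintegral_add_pow_le (hg i) (by fun_prop) hp (h i) ih
  have hmono : ∀ {s t : Finset ι}, s ≤ t → ∀ x, ∑ i ∈ s, g i x ≤ ∑ i ∈ t, g i x :=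
    fun hst x => Finset.sum_le_sum_of_subset hst
  simp_rw [ENNReal.tsum_eq_iSup_sum, ENNReal.iSup_pow_of_ne_zero hp]
  rw [lintegral_iSup_directed (fun s => by fun_prop) (directed_of_isDirected_le fun s t hst x =>
    pow_le_pow_left₀ zero_le (hmono hst x) p)]
  refine iSup_le fun s => (hfin s).trans ?_
  gcongr
  exact le_iSup (fun s : Finset ι => (∑ i ∈ s, a i) ^ p) s

/-- The absolute moments of the standard normal distribution. -/
noncomputable def gaussianMoment (p : ℕ) : ℝ≥0∞ := ∫⁻ x, ‖x‖ₑ ^ p ∂(gaussianReal 0 1)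

theorem gaussianMoment_ne_top (p : ℕ) : gaussianMoment p ≠ ∞ := by
  have h := (memLp_id_gaussianReal (μ := 0) (v := 1) p).eLpNorm_lt_top
  rcases Nat.eq_zero_or_pos p with rfl | hp
  · simp [gaussianMoment]
  have h2 := lintegral_rpow_enorm_lt_top_of_eLpNorm_lt_top (p := p) (by simpa using hp.ne')
    (by simp) h
  simpa [gaussianMoment] using h2.ne

theorem gaussianMoment_two : gaussianMoment 2 = 1 := by
  have hv := variance_fun_id_gaussianReal (μ := 0) (v := 1)
  rw [variance_of_integral_eq_zero (by fun_prop) integral_id_gaussianReal] at hv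
  simp_rw [gaussianMoment, enorm_sq_eq_ofReal, Real.norm_eq_abs, sq_abs]
  have h := ofReal_integral_eq_lintegral_ofReal
    (memLp_id_gaussianReal (μ := 0) (v := 1) 2).integrable_sq (.of_forall fun x => sq_nonneg x)
  simp only [id_eq] at h
  rw [← h, hv]
  simp

theorem lintegral_enorm_pow_gaussianReal (v : ℝ≥0) (p : ℕ) :
    ∫⁻ x, ‖x‖ₑ ^ (2 * p) ∂(gaussianReal 0 v) = gaussianMoment (2 * p) * (v : ℝ≥0∞) ^ p := by
  have h := gaussianReal_map_const_mul (μ := 0) (v := 1) (√(v : ℝ))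
  have hv : NNReal.mk (√(v : ℝ) ^ 2) (sq_nonneg _) * 1 = v := by
    ext; simp
  rw [hv, mul_zero] at h
  rw [← h, lintegral_map (by fun_prop) (by fun_prop)]
  simp_rw [enorm_mul, mul_pow]
  rw [lintegral_const_mul _ (by fun_prop), mul_comm, gaussianMoment, pow_mul]
  congr 2
  rw [enorm_sq_eq_ofReal, Real.norm_eq_abs, sq_abs, Real.sq_sqrt v.coe_nonneg]
  simp

universe u

variable {H : Type u} [NormedAddCommGroup H] [InnerProductSpace ℝ H] [CompleteSpace H]
  [MeasurableSpace H] [BorelSpace H] {μ : Measure H} {T : H →L[ℝ] H}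

theorem IsCenteredGaussian.isProbabilityMeasure (hμ : IsCenteredGaussian μ T) :
    IsProbabilityMeasure μ :=
  hμ.1.toIsProbabilityMeasure

variable [SecondCountableTopology H]

theorem IsCenteredGaussian.integral_inner_mul_inner (hμ : IsCenteredGaussian μ T) (x y : H) :
    ∫ z, ⟪x, z⟫ * ⟪y, z⟫ ∂μ = ⟪T x, y⟫ := by
  have := hμ.1
  rw [← hμ.2.2, covarianceOperator_inner IsGaussian.memLp_two_id]

theorem IsCenteredGaussian.integral_inner (hμ : IsCenteredGaussian μ T) (x : H) :
    ∫ z, ⟪x, z⟫ ∂μ = 0 := by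
  have := hμ.1
  have h := _root_.integral_inner (𝕜 := ℝ) (IsGaussian.integrable_id (μ := μ)) x
  simpa [hμ.2.1] using h

theorem IsCenteredGaussian.map (hμ : IsCenteredGaussian μ T) (A : H →L[ℝ] H) :
    IsCenteredGaussian (μ.map A) (A ∘L T ∘L A.adjoint) := by
  have := hμ.1
  refine ⟨inferInstance, ?_, ?_⟩
  · rw [integral_map (by fun_prop) (by fun_prop)]
    have h := A.integral_comp_comm (IsGaussian.integrable_id (μ := μ))
    simpa [hμ.2.1] using h
  · ext x
    refine ext_inner_right ℝ fun y => ?_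
    rw [covarianceOperator_inner IsGaussian.memLp_two_id, integral_map (by fun_prop)
      (by fun_prop)]
    simp_rw [← ContinuousLinearMap.adjoint_inner_left]
    rw [hμ.integral_inner_mul_inner]
    simp [ContinuousLinearMap.adjoint_inner_right]

theorem IsCenteredGaussian.map_inner (hμ : IsCenteredGaussian μ T) (x : H) :
    μ.map (fun y => ⟪x, y⟫) = gaussianReal 0 ⟪x, T x⟫.toNNReal := by
  have := hμ.1
  have h := IsGaussian.map_eq_gaussianReal (μ := μ) (innerSL ℝ x)
  have h0 : ∫ y, (innerSL ℝ x) y ∂μ = 0 := hμ.integral_inner x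
  rw [h0, variance_of_integral_eq_zero (by fun_prop) h0] at h
  have h2 : ∫ y, (innerSL ℝ x) y ^ 2 ∂μ = ⟪x, T x⟫ := by
    rw [real_inner_comm, ← hμ.integral_inner_mul_inner]
    simp [sq]
  rw [h2] at h
  exact h

theorem IsCenteredGaussian.lintegral_inner_pow (hμ : IsCenteredGaussian μ T) (x : H) (p : ℕ) :
    ∫⁻ y, ‖⟪x, y⟫‖ₑ ^ (2 * p) ∂μ =
      gaussianMoment (2 * p) * ENNReal.ofReal ⟪x, T x⟫ ^ p := by
  have h := lintegral_map (μ := μ) (f := fun r : ℝ => ‖r‖ₑ ^ (2 * p)) (g := fun y => ⟪x, y⟫)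
    (by fun_prop) (by fun_prop)
  rw [← h, hμ.map_inner, lintegral_enorm_pow_gaussianReal]
  rfl

theorem IsCenteredGaussian.lintegral_inner_apply_pow (hμ : IsCenteredGaussian μ T)
    (hpos : T.IsPositive) (hc : IsCompactOperator T) (A : H →L[ℝ] H) (x : H) (p : ℕ) :
    ∫⁻ y, (‖⟪x, A y⟫‖ₑ ^ 2) ^ p ∂μ =
      gaussianMoment (2 * p) * (‖(sqrtOp T ∘L A.adjoint) x‖ₑ ^ 2) ^ p := by
  simp_rw [← ContinuousLinearMap.adjoint_inner_left, ← pow_mul]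
  rw [hμ.lintegral_inner_pow, ofReal_inner_eq hpos hc, ContinuousLinearMap.comp_apply, pow_mul]

theorem IsCenteredGaussian.lintegral_enorm_sq (hμ : IsCenteredGaussian μ T)
    (hpos : T.IsPositive) (hc : IsCompactOperator T) (A : H →L[ℝ] H) :
    ∫⁻ y, ‖A y‖ₑ ^ 2 ∂μ = hsSq (A ∘L sqrtOp T) := by
  have := countable_of_hilbertBasis (onb H)
  simp_rw [enorm_sq_eq (onb H) (A _)]
  rw [lintegral_tsum (fun i => by fun_prop), ← hsSq_comp_adjoint_eq (sqrtOp_spec hpos hc).1, hsSq]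
  refine tsum_congr fun i => ?_
  have := hμ.lintegral_inner_apply_pow hpos hc A (onb H i) 1
  simpa [gaussianMoment_two] using this

/-- All moments of a Gaussian vector are controlled by its second moment. -/
theorem IsCenteredGaussian.lintegral_enorm_pow_le (hμ : IsCenteredGaussian μ T)
    (hpos : T.IsPositive) (hc : IsCompactOperator T) (A : H →L[ℝ] H) {p : ℕ} (hp : p ≠ 0) :
    ∫⁻ y, ‖A y‖ₑ ^ (2 * p) ∂μ ≤ gaussianMoment (2 * p) * hsSq (A ∘L sqrtOp T) ^ p := by
  have := countable_of_hilbertBasis (onb H)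
  simp_rw [pow_mul, enorm_sq_eq (onb H) (A _)]
  rw [← hsSq_comp_adjoint_eq (sqrtOp_spec hpos hc).1, hsSq]
  exact lintegral_tsum_pow_le (fun i => by fun_prop) hp fun i =>
    (hμ.lintegral_inner_apply_pow hpos hc A (onb H i) p).le

end Moments

/-! ### Negative moments of the distance of a Gaussian vector to a subspace. -/

section InverseMoments

theorem integrable_abs_rpow_mul_exp_neg_mul_sq {b s : ℝ} (hb : 0 < b) (hs : -1 < s) :
    Integrable fun x : ℝ => |x| ^ s * Real.exp (-b * x ^ 2) := by
  have h := integrableOn_rpow_mul_exp_neg_mul_sq hb hs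
  have h1 : IntegrableOn (fun x : ℝ => |x| ^ s * Real.exp (-b * x ^ 2)) (Set.Ioi 0) :=
    h.congr_fun (fun x hx => by simp [abs_of_pos (Set.mem_Ioi.1 hx)]) measurableSet_Ioi
  have h2 : IntegrableOn (fun x : ℝ => |x| ^ s * Real.exp (-b * x ^ 2)) (Set.Iic 0) := by
    rw [integrableOn_Iic_iff_integrableOn_Iio]
    have h3 := (Measure.measurePreserving_neg (volume : Measure ℝ)).integrableOn_comp_preimage
      (MeasurableEquiv.neg ℝ).measurableEmbedding (s := Set.Ioi 0)
      (f := fun x : ℝ => |x| ^ s * Real.exp (-b * x ^ 2))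
    have h4 := h3.2 h1
    simpa [Function.comp_def] using h4
  rw [← integrableOn_univ, ← Set.Iic_union_Ioi (a := (0 : ℝ))]
  exact h2.union h1

theorem lintegral_inv_enorm_rpow_gaussianReal_ne_top {s : ℝ} (hs : s < 1) :
    ∫⁻ x, (‖x‖ₑ⁻¹) ^ s ∂(gaussianReal 0 1) ≠ ∞ := by
  rw [gaussianReal_of_var_ne_zero 0 one_ne_zero,
    lintegral_withDensity_eq_lintegral_mul _ (measurable_gaussianPDF 0 1) (by fun_prop)]
  have h := (integrable_abs_rpow_mul_exp_neg_mul_sq (b := 1 / 2) (s := -s) (by norm_num)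
    (by linarith)).const_mul (√(2 * Real.pi))⁻¹
  refine ne_top_of_le_ne_top h.2.ne (lintegral_mono_ae ?_)
  have h0 : ∀ᵐ x : ℝ, x ≠ 0 := by simp [ae_iff]
  filter_upwards [h0] with x hx
  have hx' : 0 < |x| := abs_pos.2 hx
  rw [Pi.mul_apply, ENNReal.inv_rpow, ← ENNReal.rpow_neg, ← ofReal_norm, Real.norm_eq_abs,
    ENNReal.ofReal_rpow_of_pos hx', ← ofReal_norm, Real.norm_of_nonneg (by positivity)]
  simp only [gaussianPDF, gaussianPDFReal]
  rw [← ENNReal.ofReal_mul (by positivity)]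
  refine ENNReal.ofReal_le_ofReal (le_of_eq ?_)
  simp only [NNReal.coe_one, mul_one, sub_zero]
  rw [show -x ^ 2 / 2 = -(1 / 2) * x ^ 2 by ring]
  ring

universe u

variable {H : Type u} [NormedAddCommGroup H] [InnerProductSpace ℝ H]

/-- The inverse of the distance from `x` to the span of `y`. -/
noncomputable def recipDist {n : ℕ} (x : H) (y : Fin n → H) : ℝ≥0∞ :=
  ⨆ c : Fin n → ℚ, (‖x - ∑ i, (c i : ℝ) • y i‖ₑ)⁻¹

/-- The supremum runs over rational coefficients to be measurable; density and continuity recover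
all real coefficients. -/
theorem inv_enorm_le_recipDist {n : ℕ} (x : H) (y : Fin n → H) (c : Fin n → ℝ) :
    (‖x - ∑ i, c i • y i‖ₑ)⁻¹ ≤ recipDist x y := by
  have hcont : Continuous fun c : Fin n → ℝ => (‖x - ∑ i, c i • y i‖ₑ)⁻¹ := by fun_prop
  have hd : DenseRange fun (c : Fin n → ℚ) (i : Fin n) => (c i : ℝ) :=
    DenseRange.piMap fun _ => Rat.denseRange_cast
  have hcl : IsClosed {c : Fin n → ℝ | (‖x - ∑ i, c i • y i‖ₑ)⁻¹ ≤ recipDist x y} :=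
    isClosed_le hcont continuous_const
  exact hd.induction_on (p := fun c => (‖x - ∑ i, c i • y i‖ₑ)⁻¹ ≤ recipDist x y) c hcl
    fun c => le_iSup (fun c : Fin n → ℚ => (‖x - ∑ i, (c i : ℝ) • y i‖ₑ)⁻¹) c

/-- By Cauchy–Schwarz, pairing with a vector orthogonal to the span bounds the distance from below.
-/
theorem recipDist_le {n : ℕ} (x : H) (y : Fin n → H) {v : H} (hv : v ≠ 0)
    (h : ∀ i, ⟪v, y i⟫ = 0) : recipDist x y ≤ ‖v‖ₑ * (‖⟪v, x⟫‖ₑ)⁻¹ := by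
  refine iSup_le fun c => ?_
  have h1 : ⟪v, x⟫ = ⟪v, x - ∑ i, (c i : ℝ) • y i⟫ := by
    simp [inner_sub_right, inner_sum, inner_smul_right, h]
  have h2 : ‖⟪v, x⟫‖ₑ ≤ ‖v‖ₑ * ‖x - ∑ i, (c i : ℝ) • y i‖ₑ := by
    rw [h1, ← ofReal_norm, ← ofReal_norm, ← ofReal_norm, ← ENNReal.ofReal_mul (norm_nonneg _)]
    exact ENNReal.ofReal_le_ofReal (norm_inner_le_norm _ _)
  have hv0 : ‖v‖ₑ ≠ 0 := by simpa using hv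
  have hvt : ‖v‖ₑ ≠ ∞ := by simp
  have h3 : ‖v‖ₑ * (‖⟪v, x⟫‖ₑ)⁻¹ = (‖v‖ₑ⁻¹ * ‖⟪v, x⟫‖ₑ)⁻¹ := by
    rw [ENNReal.mul_inv (.inl (by simp)) (.inl (by simpa using hv)), inv_inv]
  rw [h3, ENNReal.inv_le_inv]
  calc ‖v‖ₑ⁻¹ * ‖⟪v, x⟫‖ₑ ≤ ‖v‖ₑ⁻¹ * (‖v‖ₑ * ‖x - ∑ i, (c i : ℝ) • y i‖ₑ) := by gcongr
    _ = _ := by rw [← mul_assoc, ENNReal.inv_mul_cancel hv0 hvt, one_mul]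

theorem measurable_recipDist [SecondCountableTopology H] [MeasurableSpace H] [BorelSpace H]
    {n : ℕ} : Measurable fun z : H × (Fin n → H) => recipDist z.1 z.2 := by
  unfold recipDist
  exact Measurable.iSup fun c => by fun_prop

variable [CompleteSpace H]

/-- If the rank of `T` is at least `n + d`, then there are `d` vectors orthogonal to `n` given ones,
of norm bounded independently of these, and orthonormal for the inner product `⟪·, T ·⟫`. -/
theorem exists_orthonormal_comp {T : H →L[ℝ] H} (hpos : T.IsPositive)
    (hc : IsCompactOperator T) {n d : ℕ}
    (hrank : ((n + d : ℕ) : Cardinal) ≤ LinearMap.rank T.toLinearMap) :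
    ∃ C : ℝ, ∀ y : Fin n → H, ∃ v : Fin d → H, (∀ i j, ⟪v i, y j⟫ = 0) ∧ (∀ i, ‖v i‖ ≤ C) ∧
      Orthonormal ℝ fun i => sqrtOp T (v i) := by
  obtain ⟨s, hs, hli⟩ := LinearMap.le_rank_iff_exists_linearIndependent_finset.1 hrank
  let e : Fin (n + d) ≃ s := (Fintype.equivFinOfCardEq (by simpa using hs)).symm
  let L : EuclideanSpace ℝ (Fin (n + d)) →L[ℝ] H := quasiMatrix fun i => (e i : H)
  have hL : ∀ a, L a = ∑ i, a i • (e i : H) := fun a => by simp [L, quasiMatrix]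
  let M : EuclideanSpace ℝ (Fin (n + d)) →L[ℝ] H := sqrtOp T ∘L L
  have hker : LinearMap.ker M.toLinearMap = ⊥ := by
    rw [LinearMap.ker_eq_bot']
    intro a ha
    have h1 : T (L a) = 0 := by
      rw [← sqrtOp_sqrtOp_apply hpos hc]
      have : sqrtOp T (L a) = 0 := ha
      rw [this, map_zero]
    rw [hL, map_sum] at h1
    simp_rw [map_smul] at h1
    have h2 := Fintype.linearIndependent_iff.1 (hli.comp e e.injective) a (by simpa using h1)
    ext i
    simpa using h2 i
  -- An injective map on a finite-dimensional space is bounded below. The constant is fixed before y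
  -- is chosen, hence the uniform bound on the vectors v_i.
  obtain ⟨K, hK0, hK⟩ := LinearMap.exists_antilipschitzWith M.toLinearMap hker
  refine ⟨‖L‖ * K, fun y => ?_⟩
  let N : EuclideanSpace ℝ (Fin (n + d)) →ₗ[ℝ] (Fin n → ℝ) :=
    LinearMap.pi fun j => (innerSL ℝ (y j) ∘L L).toLinearMap
  let W := (LinearMap.ker N).map M.toLinearMap
  -- Orthogonality to the y_j imposes n linear conditions on a space of dimension n + d.
  have hW : d ≤ Module.finrank ℝ W := by
    have h1 := LinearMap.finrank_range_add_finrank_ker N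
    have h2 := Submodule.finrank_le (LinearMap.range N)
    have h3 : Module.finrank ℝ W = Module.finrank ℝ (LinearMap.ker N) :=
      LinearEquiv.finrank_eq ((Submodule.equivMapOfInjective M.toLinearMap
        (LinearMap.ker_eq_bot.1 hker) _).symm)
    simp only [finrank_euclideanSpace, Fintype.card_fin, Module.finrank_fintype_fun_eq_card]
      at h1 h2
    omega
  let f : Fin d → W := fun i => stdOrthonormalBasis ℝ W (Fin.castLE hW i)
  have hf : Orthonormal ℝ fun i => (f i : H) :=
    ((stdOrthonormalBasis ℝ W).orthonormal.comp _ (Fin.castLE_injective hW)).comp_linearIsometry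
      W.subtypeₗᵢ
  have hfa : ∀ i, ∃ a, N a = 0 ∧ M a = f i := fun i => by
    obtain ⟨a, ha, ha'⟩ := (f i).2
    exact ⟨a, ha, ha'⟩
  choose a ha ha' using hfa
  refine ⟨fun i => L (a i), fun i j => ?_, fun i => ?_, ?_⟩
  · rw [real_inner_comm]
    exact congrFun (ha i) j
  · refine (L.le_opNorm _).trans ?_
    gcongr
    have h1 := hK.le_mul_dist (a i) 0
    rw [dist_zero_right, map_zero, dist_zero_right] at h1
    have h2 : M.toLinearMap (a i) = f i := ha' i
    rw [h2, hf.1 i, mul_one] at h1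
    exact h1
  · have : (fun i => sqrtOp T (L (a i))) = fun i => (f i : H) := funext fun i => ha' i
    rw [this]
    exact hf

variable [SecondCountableTopology H] [MeasurableSpace H] [BorelSpace H] {μ : Measure H}
  {T : H →L[ℝ] H}

/-- The functionals are jointly Gaussian, and orthonormality for ⟪·, T ·⟫ makes them uncorrelated.
-/
theorem IsCenteredGaussian.iIndepFun_inner (hμ : IsCenteredGaussian μ T) (hpos : T.IsPositive)
    (hc : IsCompactOperator T) {d : ℕ} {v : Fin d → H}
    (hv : Orthonormal ℝ fun i => sqrtOp T (v i)) :
    iIndepFun (fun i (x : H) => ⟪v i, x⟫) μ := by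
  have := hμ.1
  have := hμ.isProbabilityMeasure
  have hG : HasGaussianLaw (fun x i => ⟪v i, x⟫) μ :=
    (IsGaussian.hasGaussianLaw_id (μ := μ)).map
      (ContinuousLinearMap.pi fun i => innerSL ℝ (v i))
  refine hG.iIndepFun_of_covariance_eq_zero fun i j hij => ?_
  have hL : ∀ i, MemLp (fun x => ⟪v i, x⟫) 2 μ := fun i =>
    IsGaussian.memLp_dual μ (innerSL ℝ (v i)) 2 (by simp)
  rw [covariance_eq_sub (hL i) (hL j), hμ.integral_inner]
  have h := hμ.integral_inner_mul_inner (v i) (v j)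
  rw [real_inner_comm, ← inner_sqrtOp_sqrtOp hpos hc, hv.2 hij.symm] at h
  simpa using h

/-- Three vectors orthogonal to y give three independent standard normal coordinates g_i with 1/dist
≤ C/|g_i|. Multiplying the three bounds raised to the power 8/9 gives the power 8/3, and each
|g_i|^{-8/9} is integrable because 8/9 < 1. The bound is uniform in y, ready for Fubini. -/
theorem IsCenteredGaussian.exists_lintegral_recipDist_le (hμ : IsCenteredGaussian μ T)
    (hpos : T.IsPositive) (hc : IsCompactOperator T) {n : ℕ}
    (hrank : ((n + 3 : ℕ) : Cardinal) ≤ LinearMap.rank T.toLinearMap) :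
    ∃ C : ℝ≥0∞, C ≠ ∞ ∧ ∀ y : Fin n → H, ∫⁻ x, recipDist x y ^ (8 / 3 : ℝ) ∂μ ≤ C := by
  obtain ⟨C, hC⟩ := exists_orthonormal_comp hpos hc hrank
  let m := ∫⁻ x, (‖x‖ₑ⁻¹) ^ (8 / 9 : ℝ) ∂(gaussianReal 0 1)
  have hm : m ≠ ∞ :=
    lintegral_inv_enorm_rpow_gaussianReal_ne_top (by norm_num)
  refine ⟨∏ _i : Fin 3, (ENNReal.ofReal C ^ (8 / 9 : ℝ) * m), ?_, fun y => ?_⟩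
  · exact ENNReal.prod_ne_top fun i _ =>
      ENNReal.mul_ne_top (ENNReal.rpow_ne_top_of_nonneg (by norm_num) ENNReal.ofReal_ne_top) hm
  obtain ⟨v, hvy, hvC, hv⟩ := hC y
  have hv0 : ∀ i, v i ≠ 0 := fun i h0 => by
    have := hv.1 i
    simp [h0] at this
  have hle : ∀ x i, recipDist x y ^ (8 / 9 : ℝ) ≤
      ENNReal.ofReal C ^ (8 / 9 : ℝ) * (‖⟪v i, x⟫‖ₑ⁻¹) ^ (8 / 9 : ℝ) := fun x i => by
    rw [← ENNReal.mul_rpow_of_nonneg _ _ (by norm_num)]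
    refine ENNReal.rpow_le_rpow ((recipDist_le x y (hv0 i) (hvy i)).trans ?_) (by norm_num)
    gcongr
    rw [← ofReal_norm]
    exact ENNReal.ofReal_le_ofReal (hvC i)
  have hle2 : ∀ x, recipDist x y ^ (8 / 3 : ℝ) ≤
      ∏ i, ENNReal.ofReal C ^ (8 / 9 : ℝ) * (‖⟪v i, x⟫‖ₑ⁻¹) ^ (8 / 9 : ℝ) := fun x => by
    have h1 : recipDist x y ^ (8 / 3 : ℝ) = ∏ _i : Fin 3, recipDist x y ^ (8 / 9 : ℝ) := by
      rw [Finset.prod_const, Finset.card_univ, Fintype.card_fin, ← ENNReal.rpow_natCast,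
        ← ENNReal.rpow_mul]
      norm_num
    rw [h1]
    exact Finset.prod_le_prod' fun i _ => hle x i
  refine (lintegral_mono hle2).trans (le_of_eq ?_)
  have hind := (hμ.iIndepFun_inner hpos hc hv).comp
    (fun _ r => ENNReal.ofReal C ^ (8 / 9 : ℝ) * (‖r‖ₑ⁻¹) ^ (8 / 9 : ℝ)) (fun _ => by fun_prop)
  have h2 := lintegral_prod_eq_prod_lintegral_of_indepFun Finset.univ _ hind
    (fun i => by simp only [Function.comp_def]; fun_prop)
  simp only [Function.comp_def] at h2
  rw [h2]
  refine Finset.prod_congr rfl fun i _ => ?_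
  rw [lintegral_const_mul _ (by fun_prop)]
  congr 1
  have h3 := lintegral_map (μ := μ) (f := fun r : ℝ => (‖r‖ₑ⁻¹) ^ (8 / 9 : ℝ))
    (g := fun y => ⟪v i, y⟫) (by fun_prop) (by fun_prop)
  rw [← h3, hμ.map_inner, ← inner_sqrtOp_sqrtOp hpos hc, real_inner_self_eq_norm_sq, hv.1 i]
  simp [m]

end InverseMoments

/-! ### Deterministic perturbation of the Nyström approximation. -/

section Projections

universe u

variable {H : Type u} [NormedAddCommGroup H] [InnerProductSpace ℝ H]

theorem quasiMatrix_apply {n : ℕ} (f : Fin n → H) (a : EuclideanSpace ℝ (Fin n)) :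
    quasiMatrix f a = ∑ i, a i • f i := by
  simp [quasiMatrix]

theorem mem_range_quasiMatrix {n : ℕ} {f : Fin n → H} {v : H} :
    v ∈ LinearMap.range (quasiMatrix f).toLinearMap ↔ ∃ c : Fin n → ℝ, v = ∑ i, c i • f i := by
  constructor
  · rintro ⟨a, rfl⟩
    exact ⟨fun i => a i, quasiMatrix_apply f a⟩
  · rintro ⟨c, rfl⟩
    exact ⟨WithLp.toLp 2 c, by simp [quasiMatrix_apply]⟩

theorem norm_rangeProj_apply_le {r : ℕ} (y : Fin r → H) (x : H) : ‖rangeProj y x‖ ≤ ‖x‖ :=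
  Submodule.norm_starProjection_apply_le _ x

/-- The crude bound, for perturbations too large to keep the columns well conditioned. -/
theorem norm_apply_sub_rangeProj_le' (S : H →L[ℝ] H) {r : ℕ} (z : Fin r → H) (v : H) :
    ‖S (v - rangeProj z v)‖ ≤ ‖S‖ * ‖v‖ := by
  refine (S.le_opNorm _).trans ?_
  gcongr
  have : v - rangeProj z v = (LinearMap.range (quasiMatrix z).toLinearMap)ᗮ.starProjection v := by
    rw [Submodule.starProjection_orthogonal']
    rfl
  rw [this]
  exact Submodule.norm_starProjection_apply_le _ v

/-- At the index m where |c_m| is largest, the perturbation contributes at most s |c_m| ∑ ‖e_j‖ ≤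
|c_m| / 2, which is absorbed on the left; this doubles s. -/
theorem abs_le_of_perturbation {r : ℕ} {y e : Fin r → H} {s : ℝ} (hs0 : 0 ≤ s)
    (hs : ∀ (c : Fin r → ℝ) l, |c l| ≤ s * ‖∑ i, c i • y i‖)
    (ha : 2 * (s * ∑ j, ‖e j‖) ≤ 1) (c : Fin r → ℝ) (l : Fin r) :
    |c l| ≤ 2 * s * ‖∑ i, c i • (y i - e i)‖ := by
  obtain ⟨m, -, hm⟩ := Finset.exists_max_image Finset.univ (fun i => |c i|) ⟨l, Finset.mem_univ l⟩
  have h1 : ‖∑ i, c i • y i‖ ≤ ‖∑ i, c i • (y i - e i)‖ + |c m| * ∑ j, ‖e j‖ := by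
    calc ‖∑ i, c i • y i‖ = ‖∑ i, c i • (y i - e i) + ∑ i, c i • e i‖ := by
          rw [← Finset.sum_add_distrib]
          simp [← smul_add]
      _ ≤ _ := by
          refine (norm_add_le _ _).trans ?_
          gcongr
          refine (norm_sum_le _ _).trans ?_
          rw [Finset.mul_sum]
          refine Finset.sum_le_sum fun i hi => ?_
          rw [norm_smul, Real.norm_eq_abs]
          have := hm i hi
          gcongr
  have h2 := hs c m
  have h3 := mul_le_mul_of_nonneg_left h1 hs0
  have h4 := mul_le_mul_of_nonneg_left ha (abs_nonneg (c m))
  have h5 := hm l (Finset.mem_univ l)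
  linarith

/-- For v = ∑ c_i y_i put x = ∑ c_i (y_i - z_i); then v - P v = x - P x, as ∑ c_i z_i is fixed by P.
The term S x sees only S(y_i - z_i), and ‖P x‖² = ⟪P x, x⟫ expands into the inner products ⟪z_i, y_j
- z_j⟫. The norms ‖y_i - z_i‖, of size only √δ in the application, never appear to the first power.
-/
theorem norm_apply_sub_rangeProj_le (S : H →L[ℝ] H) {r : ℕ} {y z : Fin r → H} {s t ρ β : ℝ}
    (hs0 : 0 ≤ s) (ht0 : 0 ≤ t)
    (hs : ∀ (c : Fin r → ℝ) l, |c l| ≤ s * ‖∑ i, c i • y i‖)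
    (ht : ∀ (c : Fin r → ℝ) l, |c l| ≤ t * ‖∑ i, c i • z i‖)
    (hρ : ∑ j, ‖S (y j - z j)‖ ≤ ρ) (hβ : ∑ i, ∑ j, |⟪z i, y j - z j⟫| ≤ β)
    {v : H} (hv : v ∈ LinearMap.range (quasiMatrix y).toLinearMap) :
    ‖S (v - rangeProj z v)‖ ≤ (s * ρ + ‖S‖ * (s * t * β)) * ‖v‖ := by
  obtain ⟨c, rfl⟩ := mem_range_quasiMatrix.1 hv
  set v := ∑ i, c i • y i with hvdef
  let x := ∑ i, c i • (y i - z i)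
  have hvx : v = x + ∑ i, c i • z i := by
    simp only [x, hvdef, smul_sub, Finset.sum_sub_distrib]
    abel
  have hz : rangeProj z (∑ i, c i • z i) = ∑ i, c i • z i :=
    Submodule.starProjection_eq_self_iff.2 (mem_range_quasiMatrix.2 ⟨c, rfl⟩)
  have h1 : v - rangeProj z v = x - rangeProj z x := by
    rw [hvx, map_add, hz]
    abel
  have hSx : ‖S x‖ ≤ s * ρ * ‖v‖ := by
    calc ‖S x‖ = ‖∑ i, c i • S (y i - z i)‖ := by simp [x, map_sum]
      _ ≤ ∑ i, |c i| * ‖S (y i - z i)‖ := by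
        refine (norm_sum_le _ _).trans (Finset.sum_le_sum fun i _ => ?_)
        rw [norm_smul, Real.norm_eq_abs]
      _ ≤ ∑ i, s * ‖v‖ * ‖S (y i - z i)‖ := by
        gcongr with i
        exact hs c i
      _ = s * ‖v‖ * ∑ i, ‖S (y i - z i)‖ := by rw [Finset.mul_sum]
      _ ≤ s * ‖v‖ * ρ := by gcongr
      _ = _ := by ring
  have hPx : ‖rangeProj z x‖ ≤ s * t * β * ‖v‖ := by
    obtain ⟨a, ha⟩ := mem_range_quasiMatrix.1
      (show rangeProj z x ∈ LinearMap.range (quasiMatrix z).toLinearMap from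
        Submodule.starProjection_apply_mem _ _)
    have h2 : ‖rangeProj z x‖ ^ 2 ≤ s * t * β * ‖v‖ * ‖rangeProj z x‖ := by
      have h3 : ‖rangeProj z x‖ ^ 2 = ⟪rangeProj z x, x⟫ := by
        have h4 : ⟪rangeProj z x, x - rangeProj z x⟫ = 0 :=
          Submodule.sub_starProjection_mem_orthogonal x _ (Submodule.starProjection_apply_mem _ _)
        rw [inner_sub_right, real_inner_self_eq_norm_sq] at h4
        linarith
      calc ‖rangeProj z x‖ ^ 2 = ∑ i, ∑ j, a i * (c j * ⟪z i, y j - z j⟫) := by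
            rw [h3, ha]
            simp only [x, sum_inner, inner_sum, inner_smul_left, inner_smul_right, conj_trivial]
            rw [Finset.sum_comm]
            refine Finset.sum_congr rfl fun i _ => ?_
            rw [Finset.mul_sum]
            exact Finset.sum_congr rfl fun j _ => by ring
        _ ≤ ∑ i, ∑ j, (t * ‖rangeProj z x‖) * ((s * ‖v‖) * |⟪z i, y j - z j⟫|) := by
            refine Finset.sum_le_sum fun i _ => Finset.sum_le_sum fun j _ => ?_
            refine (le_abs_self _).trans ?_
            rw [abs_mul, abs_mul]
            have h5 := ht a i
            rw [← ha] at h5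
            have h6 := hs c j
            gcongr
        _ = (t * ‖rangeProj z x‖) * ((s * ‖v‖) * ∑ i, ∑ j, |⟪z i, y j - z j⟫|) := by
            simp_rw [Finset.mul_sum]
        _ ≤ (t * ‖rangeProj z x‖) * ((s * ‖v‖) * β) := by gcongr
        _ = _ := by ring
    rcases (norm_nonneg (rangeProj z x)).eq_or_lt with h0 | h0
    · have hβ0 : 0 ≤ β := le_trans (by positivity) hβ
      rw [← h0]
      positivity
    · rw [sq] at h2
      exact le_of_mul_le_mul_right h2 h0
  rw [h1, map_sub]
  calc ‖S x - S (rangeProj z x)‖ ≤ ‖S x‖ + ‖S (rangeProj z x)‖ := norm_sub_le _ _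
    _ ≤ s * ρ * ‖v‖ + ‖S‖ * (s * t * β * ‖v‖) := by
        gcongr
        exact (S.le_opNorm _).trans (by gcongr)
    _ = _ := by ring

theorem norm_comp_sub_rangeProj_le (S : H →L[ℝ] H) {r : ℕ} {y z : Fin r → H} {K : ℝ}
    (hK : 0 ≤ K) (h : ∀ v ∈ LinearMap.range (quasiMatrix y).toLinearMap,
      ‖S (v - rangeProj z v)‖ ≤ K * ‖v‖) :
    ‖S ∘L (1 - rangeProj z) ∘L rangeProj y‖ ≤ K := by
  refine ContinuousLinearMap.opNorm_le_bound _ hK fun x => ?_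
  refine (h (rangeProj y x) (Submodule.starProjection_apply_mem _ _)).trans ?_
  gcongr
  exact norm_rangeProj_apply_le y x

variable [CompleteSpace H]

theorem rangeProj_adjoint {r : ℕ} (y : Fin r → H) : (rangeProj y).adjoint = rangeProj y :=
  (isSelfAdjoint_starProjection _).adjoint_eq

/-- Rests on P_y - P_z = P_y(1 - P_z) - (1 - P_y)P_z. Between two factors S, each term is S times,
or times S, an operator of norm at most K, up to an adjoint. -/
theorem hsNorm_nystrom_sub_le {T : H →L[ℝ] H} (hpos : T.IsPositive) (hc : IsCompactOperator T)
    {r : ℕ} {y z : Fin r → H} {K : ℝ} (hK : 0 ≤ K)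
    (h1 : ∀ v ∈ LinearMap.range (quasiMatrix y).toLinearMap,
      ‖sqrtOp T (v - rangeProj z v)‖ ≤ K * ‖v‖)
    (h2 : ∀ v ∈ LinearMap.range (quasiMatrix z).toLinearMap,
      ‖sqrtOp T (v - rangeProj y v)‖ ≤ K * ‖v‖) :
    hsNorm (nystrom T y - nystrom T z) ≤ 2 * hsNorm (sqrtOp T) * ENNReal.ofReal K := by
  obtain ⟨hS, -⟩ := sqrtOp_spec hpos hc
  have e1 := norm_comp_sub_rangeProj_le (sqrtOp T) hK h1
  have e2 := norm_comp_sub_rangeProj_le (sqrtOp T) hK h2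
  have hSa : (sqrtOp T).adjoint = sqrtOp T := hS.isSelfAdjoint.adjoint_eq
  set S := sqrtOp T with hSdef
  have hdecomp : nystrom T y - nystrom T z =
      S ∘L (S ∘L (1 - rangeProj z) ∘L rangeProj y).adjoint -
        (S ∘L (1 - rangeProj y) ∘L rangeProj z) ∘L S := by
    have h1 : (1 : H →L[ℝ] H).adjoint = 1 := ContinuousLinearMap.adjoint_id
    simp only [ContinuousLinearMap.adjoint_comp, map_sub, rangeProj_adjoint, h1, hSa]
    ext x
    simp [nystrom, ← hSdef]
  have h3 : hsSq (nystrom T y - nystrom T z) ≤ 4 * (hsSq S * ENNReal.ofReal K ^ 2) := by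
    rw [hdecomp]
    refine (hsSq_sub_le _ _).trans ?_
    have h4 : hsSq (S ∘L (S ∘L (1 - rangeProj z) ∘L rangeProj y).adjoint) ≤
        hsSq S * ENNReal.ofReal K ^ 2 := by
      refine (hsSq_comp_le' _ _).trans ?_
      gcongr
      rw [← ofReal_norm, LinearIsometryEquiv.norm_map]
      exact ENNReal.ofReal_le_ofReal e1
    have h5 : hsSq ((S ∘L (1 - rangeProj y) ∘L rangeProj z) ∘L S) ≤
        hsSq S * ENNReal.ofReal K ^ 2 := by
      refine (hsSq_comp_le _ _).trans ?_
      rw [mul_comm]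
      gcongr
      rw [← ofReal_norm]
      exact ENNReal.ofReal_le_ofReal e2
    calc 2 * (hsSq (S ∘L (S ∘L (1 - rangeProj z) ∘L rangeProj y).adjoint) +
          hsSq ((S ∘L (1 - rangeProj y) ∘L rangeProj z) ∘L S))
        ≤ 2 * (hsSq S * ENNReal.ofReal K ^ 2 + hsSq S * ENNReal.ofReal K ^ 2) := by gcongr
      _ = _ := by ring
  rw [hsNorm_eq_hsSq_rpow, hsNorm_eq_hsSq_rpow]
  refine (ENNReal.rpow_le_rpow h3 (by norm_num)).trans (le_of_eq ?_)
  rw [ENNReal.mul_rpow_of_nonneg _ _ (by norm_num), ENNReal.mul_rpow_of_nonneg _ _ (by norm_num),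
    ← ENNReal.rpow_natCast, ← ENNReal.rpow_mul, mul_assoc]
  have h4 : (4 : ℝ≥0∞) ^ (1 / 2 : ℝ) = 2 := by
    rw [show (4 : ℝ≥0∞) = 2 ^ (2 : ℝ) by norm_num, ← ENNReal.rpow_mul]
    norm_num
  rw [h4]
  norm_num

/-- Lipschitz estimate for the Nyström approximation, where `1 / s` is a lower bound for the
smallest singular value of `[y₁, …, y_r]`. -/
theorem hsNorm_nystrom_sub_le_of_forall_abs_le {T : H →L[ℝ] H} (hpos : T.IsPositive)
    (hc : IsCompactOperator T) {r : ℕ} (y e : Fin r → H) {s : ℝ} (hs0 : 0 ≤ s)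
    (hs : ∀ (c : Fin r → ℝ) l, |c l| ≤ s * ‖∑ i, c i • y i‖) :
    hsNorm (nystrom T y - nystrom T fun i => y i - e i) ≤
      2 * hsNorm (sqrtOp T) * ENNReal.ofReal (2 * (s * ∑ j, ‖sqrtOp T (e j)‖) +
        4 * ‖sqrtOp T‖ * (s ^ 2 * (∑ i, ∑ j, |⟪y i, e j⟫| + (∑ j, ‖e j‖) ^ 2))) := by
  set S := sqrtOp T
  set ρ := ∑ j, ‖S (e j)‖
  set β := ∑ i, ∑ j, |⟪y i, e j⟫|
  set a := ∑ j, ‖e j‖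
  have hρ0 : 0 ≤ ρ := by positivity
  have hβ0 : 0 ≤ β := by positivity
  have ha0 : 0 ≤ a := by positivity
  -- For small perturbations y - e keeps the coefficient bound with 2s in place of s.
  rcases le_total (2 * (s * a)) 1 with h | h
  · have ht := abs_le_of_perturbation hs0 hs h
    refine hsNorm_nystrom_sub_le hpos hc (by positivity) (fun v hv => ?_) (fun v hv => ?_)
    · refine (norm_apply_sub_rangeProj_le S (s := s) (t := 2 * s) (ρ := ρ) (β := β + a ^ 2)
        hs0 (by positivity) hs ht ?_ ?_ hv).trans ?_
      · simp [ρ]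
      · have h1 : ∀ i j, |⟪y i - e i, y j - (y j - e j)⟫| ≤ |⟪y i, e j⟫| + ‖e i‖ * ‖e j‖ :=
          fun i j => by
            rw [sub_sub_cancel, inner_sub_left]
            exact (abs_sub _ _).trans (by gcongr; exact abs_real_inner_le_norm _ _)
        refine (Finset.sum_le_sum fun i _ => Finset.sum_le_sum fun j _ => h1 i j).trans ?_
        simp_rw [Finset.sum_add_distrib, ← Finset.mul_sum, ← Finset.sum_mul]
        rw [sq]
      · refine mul_le_mul_of_nonneg_right ?_ (norm_nonneg v)
        have h2 : 0 ≤ ‖S‖ * (s ^ 2 * (β + a ^ 2)) := by positivity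
        have h3 : 0 ≤ s * ρ := by positivity
        linarith [show ‖S‖ * (s * (2 * s) * (β + a ^ 2)) = 2 * (‖S‖ * (s ^ 2 * (β + a ^ 2))) by
          ring]
    · refine (norm_apply_sub_rangeProj_le S (s := 2 * s) (t := s) (ρ := ρ) (β := β)
        (by positivity) hs0 ht hs ?_ ?_ hv).trans ?_
      · simp [ρ]
      · simp [β]
      · refine mul_le_mul_of_nonneg_right ?_ (norm_nonneg v)
        have h2 : 0 ≤ ‖S‖ * (s ^ 2 * β) := by positivity
        have h3 : 0 ≤ ‖S‖ * (s ^ 2 * a ^ 2) := by positivity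
        nlinarith
  -- For large perturbations the a² term alone already exceeds the crude bound ‖S‖.
  · have h1 : 1 ≤ 4 * (s ^ 2 * a ^ 2) := by nlinarith
    have hK : ‖S‖ ≤ 2 * (s * ρ) + 4 * ‖S‖ * (s ^ 2 * (β + a ^ 2)) := by
      have h2 : 0 ≤ ‖S‖ * (s ^ 2 * β) := by positivity
      have h3 : 0 ≤ s * ρ := by positivity
      nlinarith [mul_le_mul_of_nonneg_left h1 (norm_nonneg S)]
    refine hsNorm_nystrom_sub_le hpos hc (by positivity) (fun v _ => ?_) (fun v _ => ?_) <;>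
    · refine (norm_apply_sub_rangeProj_le' S _ v).trans ?_
      gcongr

end Projections

/-! ### The coupling operator V and its error 1 - V. -/

section Coupling

universe u

variable {H : Type u} [NormedAddCommGroup H] [InnerProductSpace ℝ H]

variable [CompleteSpace H]

theorem quasiMatrix_adjoint_apply {n : ℕ} (w : Fin n → H) (x : H) (k : Fin n) :
    (quasiMatrix w).adjoint x k = ⟪w k, x⟫ := by
  have h := ContinuousLinearMap.adjoint_inner_right (quasiMatrix w)
    (EuclideanSpace.single k 1) x
  rw [EuclideanSpace.inner_single_left] at h
  simpa [quasiMatrix_apply] using h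

theorem quasiMatrix_adjoint_comp_self {n : ℕ} {w : Fin n → H} (hw : Orthonormal ℝ w)
    (a : EuclideanSpace ℝ (Fin n)) : (quasiMatrix w).adjoint (quasiMatrix w a) = a := by
  ext k
  rw [quasiMatrix_adjoint_apply, quasiMatrix_apply, hw.inner_right_fintype]

/-- The projection `1 - W W^*` onto the orthogonal complement of an orthonormal system. -/
noncomputable def complProj {n : ℕ} (w : Fin n → H) : H →L[ℝ] H :=
  1 - quasiMatrix w ∘L (quasiMatrix w).adjoint

theorem inner_complProj {n : ℕ} {w : Fin n → H} (hw : Orthonormal ℝ w) (x y : H) :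
    ⟪complProj w x, complProj w y⟫ =
      ⟪x, y⟫ - ⟪(quasiMatrix w).adjoint x, (quasiMatrix w).adjoint y⟫ := by
  simp only [complProj, sub_apply, one_apply_eq_self, ContinuousLinearMap.comp_apply,
    inner_sub_left, inner_sub_right]
  rw [← ContinuousLinearMap.adjoint_inner_right (quasiMatrix w),
    ← ContinuousLinearMap.adjoint_inner_left (quasiMatrix w),
    ← ContinuousLinearMap.adjoint_inner_right (quasiMatrix w), quasiMatrix_adjoint_comp_self hw]
  ring

variable {T : H →L[ℝ] H}

theorem inner_discreteCov (hpos : T.IsPositive) (hc : IsCompactOperator T) {n : ℕ}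
    (w : Fin n → H) (x y : H) : ⟪x, discreteCov T w y⟫ =
      ⟪(quasiMatrix w).adjoint (sqrtOp T x), (quasiMatrix w).adjoint (sqrtOp T y)⟫ := by
  have hS : ⟪sqrtOp T x, _⟫ = ⟪x, _⟫ := (sqrtOp_spec hpos hc).1.isSymmetric x
    (quasiMatrix w ((quasiMatrix w).adjoint (sqrtOp T y)))
  rw [ContinuousLinearMap.adjoint_inner_left]
  exact hS.symm

theorem isPositive_discreteCov (hpos : T.IsPositive) (hc : IsCompactOperator T) {n : ℕ}
    (w : Fin n → H) : (discreteCov T w).IsPositive := by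
  refine (ContinuousLinearMap.isPositive_iff _).2 ⟨fun x y => ?_, fun x => ?_⟩
  · simp only [ContinuousLinearMap.coe_coe]
    rw [real_inner_comm, inner_discreteCov hpos hc, inner_discreteCov hpos hc, real_inner_comm]
  · rw [real_inner_comm, inner_discreteCov hpos hc]
    exact real_inner_self_nonneg

theorem isCompactOperator_discreteCov (T : H →L[ℝ] H) {n : ℕ} (w : Fin n → H) :
    IsCompactOperator (discreteCov T w) :=
  ((isCompactOperator_of_locallyCompactSpace_rng (quasiMatrix w)).clm_comp (sqrtOp T)).comp_clm
    ((quasiMatrix w).adjoint ∘L sqrtOp T)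

theorem compressedTrace_eq_sum {n : ℕ} (w : Fin n → H) :
    compressedTrace T w = ∑ k, ⟪w k, T (w k)⟫ := by
  rw [compressedTrace, LinearMap.trace_eq_sum_inner _ (EuclideanSpace.basisFun (Fin n) ℝ)]
  refine Finset.sum_congr rfl fun k _ => ?_
  simp only [ContinuousLinearMap.coe_coe, ContinuousLinearMap.comp_apply,
    ContinuousLinearMap.adjoint_inner_right]
  simp [quasiMatrix_apply]

theorem ofReal_compressedTrace (hpos : T.IsPositive) (hc : IsCompactOperator T) {n : ℕ}
    (w : Fin n → H) : 0 ≤ compressedTrace T w ∧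
      ENNReal.ofReal (compressedTrace T w) = ∑ k, ‖sqrtOp T (w k)‖ₑ ^ 2 := by
  have h0 : ∀ k, 0 ≤ ⟪w k, T (w k)⟫ := fun k => hpos.inner_nonneg_right _
  rw [compressedTrace_eq_sum, ENNReal.ofReal_sum_of_nonneg fun k _ => h0 k]
  exact ⟨Finset.sum_nonneg fun k _ => h0 k,
    Finset.sum_congr rfl fun k _ => ofReal_inner_eq hpos hc _⟩

/-- Pythagoras, ‖x‖² = ‖Qx‖² + ∑ ⟪w_k, x⟫², summed over x = S e_i; this is where the trace defect of
the statement enters. -/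
theorem hsSq_complProj_comp_sqrtOp (hpos : T.IsPositive) (htr : IsTraceClass T) {n : ℕ}
    {w : Fin n → H} (hw : Orthonormal ℝ w) :
    hsSq (complProj w ∘L sqrtOp T) = ENNReal.ofReal (opTrace T - compressedTrace T w) := by
  have hc := htr.isCompactOperator
  obtain ⟨h0, h1⟩ := ofReal_compressedTrace hpos hc w
  have h2 : ∀ x, ‖x‖ₑ ^ 2 = ‖complProj w x‖ₑ ^ 2 + ∑ k, ‖⟪w k, x⟫‖ₑ ^ 2 := fun x => by
    have h3 := inner_complProj hw x x
    simp only [real_inner_self_eq_norm_sq] at h3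
    rw [EuclideanSpace.norm_sq_eq] at h3
    simp only [quasiMatrix_adjoint_apply] at h3
    simp only [enorm_sq_eq_ofReal]
    rw [← ENNReal.ofReal_sum_of_nonneg fun k _ => by positivity,
      ← ENNReal.ofReal_add (by positivity) (by positivity)]
    congr 1
    linarith
  have h3 : hsSq (sqrtOp T) =
      hsSq (complProj w ∘L sqrtOp T) + ENNReal.ofReal (compressedTrace T w) := by
    rw [hsSq, hsSq, h1]
    simp_rw [h2 (sqrtOp T (onb H _)), ENNReal.tsum_add]
    congr 1
    rw [Summable.tsum_finsetSum fun k _ => ENNReal.summable]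
    refine Finset.sum_congr rfl fun k _ => ?_
    rw [enorm_sq_eq (onb H)]
    refine tsum_congr fun i => ?_
    have hS : ⟪sqrtOp T (w k), onb H i⟫ = ⟪w k, sqrtOp T (onb H i)⟫ :=
      (sqrtOp_spec hpos hc).1.isSymmetric _ _
    rw [← hS, real_inner_comm]
  rw [hsSq_sqrtOp hpos htr] at h3
  rw [ENNReal.ofReal_sub _ h0, h3, ENNReal.add_sub_cancel_right ENNReal.ofReal_ne_top]

/-- The coupling operator: `V` maps `N(0, T)` to `N(0, T^{1/2} W W^* T^{1/2})`. -/
theorem exists_couplingOp (hpos : T.IsPositive) (hc : IsCompactOperator T) {n : ℕ}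
    {w : Fin n → H} (hw : Orthonormal ℝ w) : ∃ V : H →L[ℝ] H,
      V ∘L T ∘L V.adjoint = discreteCov T w ∧
      hsSq ((1 - V) ∘L sqrtOp T) ≤ hsSq (complProj w ∘L sqrtOp T) ∧
      hsSq (sqrtOp T ∘L (1 - V) ∘L sqrtOp T) ≤ 4 * hsSq (complProj w ∘L sqrtOp T) ^ 2 ∧
      ∀ x, 2 * ⟪sqrtOp T x, (1 - V) (sqrtOp T x)⟫ =
        ‖complProj w (sqrtOp T x)‖ ^ 2 + ‖(1 - V) (sqrtOp T x)‖ ^ 2 := by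
  have hBpos := isPositive_discreteCov hpos hc w
  have hBc := isCompactOperator_discreteCov T w
  obtain ⟨hS, hST⟩ := sqrtOp_spec hpos hc
  obtain ⟨hR, hRB⟩ := sqrtOp_spec hBpos hBc
  have hSc := isCompactOperator_sqrtOp hpos hc
  have hRc := isCompactOperator_sqrtOp hBpos hBc
  have hRR := inner_sqrtOp_sqrtOp hBpos hBc
  set S := sqrtOp T with hSdef
  set R := sqrtOp (discreteCov T w) with hRdef
  have hA : ∀ x y, ⟪S x, S y⟫ - ⟪R x, R y⟫ =
      ⟪(complProj w ∘L S) x, (complProj w ∘L S) y⟫ := fun x y => by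
    rw [hRR, inner_discreteCov hpos hc, ContinuousLinearMap.comp_apply,
      ContinuousLinearMap.comp_apply, inner_complProj hw]
  have hle : ∀ x, ‖R x‖ ≤ ‖S x‖ := fun x => by
    have h := hA x x
    rw [real_inner_self_eq_norm_sq, real_inner_self_eq_norm_sq, real_inner_self_eq_norm_sq] at h
    exact abs_le_of_sq_le_sq' (by nlinarith [sq_nonneg ‖(complProj w ∘L S) x‖])
      (norm_nonneg _) |>.2
  -- From VS = R follows V T V^* = (VS)(VS)^* = R².
  obtain ⟨V, hV⟩ := exists_comp_eq_of_norm_le hle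
  have hVS : (1 - V) ∘L S = S - R := by
    rw [← hV]; ext x; simp
  have hVSx : ∀ x, (1 - V) (S x) = S x - R x := fun x => by
    rw [← ContinuousLinearMap.comp_apply, hVS]; rfl
  refine ⟨V, ?_, ?_, ?_, fun x => ?_⟩
  · have hSa : S.adjoint = S := hS.isSelfAdjoint.adjoint_eq
    have hRa : R.adjoint = R := hR.isSelfAdjoint.adjoint_eq
    have h1 : S ∘L V.adjoint = R := by
      rw [← hRa, ← hV, ContinuousLinearMap.adjoint_comp, hSa]
    rw [← hRB, ← hST, ContinuousLinearMap.comp_assoc, h1, ← ContinuousLinearMap.comp_assoc, hV]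
  · rw [hVS]
    exact hsSq_sub_le_of_inner hS hR hSc hRc hA
  · rw [hVS]
    exact hsSq_comp_sub_le_of_inner hS hR hSc hRc hA
  -- Polarization: 2⟪Sx, Sx - Rx⟫ = ‖Sx‖² - ‖Rx‖² + ‖Sx - Rx‖², where ‖Sx‖² - ‖Rx‖² = ‖QSx‖².
  · have h := hA x x
    rw [real_inner_self_eq_norm_sq, real_inner_self_eq_norm_sq, real_inner_self_eq_norm_sq] at h
    rw [hVSx, @norm_sub_sq_real, inner_sub_right, real_inner_self_eq_norm_sq]
    simp only [ContinuousLinearMap.comp_apply] at h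
    linarith

variable [SecondCountableTopology H] [MeasurableSpace H] [BorelSpace H] {μ : Measure H}

/-- For the projection P onto this closure, E‖(1 - P)y‖² = ‖(1 - P)S‖²_HS = 0. -/
theorem IsCenteredGaussian.ae_mem_closure_range (hμ : IsCenteredGaussian μ T)
    (hpos : T.IsPositive) (hc : IsCompactOperator T) :
    ∀ᵐ y ∂μ, y ∈ (LinearMap.range (sqrtOp T).toLinearMap).topologicalClosure := by
  set N := (LinearMap.range (sqrtOp T).toLinearMap).topologicalClosure
  have hN : CompleteSpace N := (Submodule.isClosed_topologicalClosure _).completeSpace_coe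
  have h := hμ.lintegral_enorm_sq hpos hc (1 - N.starProjection)
  have h0 : (1 - N.starProjection) ∘L sqrtOp T = 0 := by
    ext x
    have : N.starProjection (sqrtOp T x) = sqrtOp T x :=
      Submodule.starProjection_eq_self_iff.2 (Submodule.le_topologicalClosure _ ⟨x, rfl⟩)
    simp [this]
  rw [h0] at h
  have h1 : hsSq (0 : H →L[ℝ] H) = 0 := by simp [hsSq]
  rw [h1, lintegral_eq_zero_iff (by fun_prop)] at h
  filter_upwards [h] with y hy
  have h2 : y - N.starProjection y = 0 := by simpa using hy
  rw [← Submodule.starProjection_eq_self_iff]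
  exact (sub_eq_zero.1 h2).symm

/-- The range of S itself may be a null set, but the identity is a closed condition and so passes to
the closure, which has full measure. -/
theorem IsCenteredGaussian.ae_two_mul_inner_eq (hμ : IsCenteredGaussian μ T)
    (hpos : T.IsPositive) (hc : IsCompactOperator T) {K Q : H →L[ℝ] H}
    (h : ∀ x, 2 * ⟪sqrtOp T x, K (sqrtOp T x)⟫ =
      ‖Q (sqrtOp T x)‖ ^ 2 + ‖K (sqrtOp T x)‖ ^ 2) :
    ∀ᵐ y ∂μ, 2 * ⟪y, K y⟫ = ‖Q y‖ ^ 2 + ‖K y‖ ^ 2 := by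
  filter_upwards [hμ.ae_mem_closure_range hpos hc] with y hy
  have hcl : IsClosed {y : H | 2 * ⟪y, K y⟫ = ‖Q y‖ ^ 2 + ‖K y‖ ^ 2} :=
    isClosed_eq (by fun_prop) (by fun_prop)
  refine closure_minimal (s := Set.range (sqrtOp T)) ?_ hcl ?_
  · rintro _ ⟨x, rfl⟩
    exact h x
  · rwa [← SetLike.mem_coe, Submodule.topologicalClosure_coe, LinearMap.coe_range] at hy

end Coupling

/-! ### Young inequalities and integration over independent columns. -/

section Integration

theorem mul_le_sq_add_sq (a b : ℝ≥0∞) : a * b ≤ a ^ 2 + b ^ 2 := by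
  rcases le_total a b with h | h
  · calc a * b ≤ b * b := by gcongr
      _ ≤ a ^ 2 + b ^ 2 := by rw [← sq]; exact le_add_self
  · calc a * b ≤ a * a := by gcongr
      _ ≤ a ^ 2 + b ^ 2 := by rw [← sq]; exact le_self_add

theorem sq_le_one_add_rpow (a : ℝ≥0∞) : a ^ 2 ≤ 1 + a ^ (8 / 3 : ℝ) := by
  rcases le_total a 1 with h | h
  · exact (pow_le_one₀ zero_le h).trans le_self_add
  · rw [← ENNReal.rpow_natCast]
    exact (ENNReal.rpow_le_rpow_of_exponent_le h (by norm_num)).trans le_add_self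

/-- Used for a = s and b = ‖S e_j‖: as E b² = O(δ²), both terms integrate to O(δ). -/
theorem mul_le_of_scale (a b : ℝ≥0∞) {δ : ℝ≥0∞} (h0 : δ ≠ 0) (ht : δ ≠ ∞) :
    a * b ≤ δ * (1 + a ^ (8 / 3 : ℝ)) + δ⁻¹ * b ^ 2 := by
  have h : a * b = δ * (a * (δ⁻¹ * b)) := by
    rw [mul_left_comm a, ← mul_assoc, ENNReal.mul_inv_cancel h0 ht, one_mul]
  have h2 : δ * (δ⁻¹ * b) ^ 2 = δ⁻¹ * b ^ 2 := by
    rw [mul_pow, sq δ⁻¹, ← mul_assoc, ← mul_assoc, ENNReal.mul_inv_cancel h0 ht, one_mul]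
  rw [h, ← h2, ← mul_add]
  gcongr
  exact (mul_le_sq_add_sq _ _).trans (by gcongr; exact sq_le_one_add_rpow a)

/-- Young with exponents 4/3 and 4 applied to a² and δ⁻¹b. Since E b⁴ = O(δ⁴) in the application,
both terms integrate to O(δ), at the price of the moment 8/3 = 2 · 4/3 of a. -/
theorem sq_mul_le_of_scale (a b : ℝ≥0∞) {δ : ℝ≥0∞} (h0 : δ ≠ 0) (ht : δ ≠ ∞) :
    a ^ 2 * b ≤ δ * a ^ (8 / 3 : ℝ) + δ⁻¹ ^ 3 * b ^ 4 := by
  have h : a ^ 2 * b = δ * (a ^ 2 * (δ⁻¹ * b)) := by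
    rw [mul_left_comm (a ^ 2), ← mul_assoc, ENNReal.mul_inv_cancel h0 ht, one_mul]
  have h2 : δ * (δ⁻¹ * b) ^ 4 = δ⁻¹ ^ 3 * b ^ 4 := by
    rw [mul_pow, pow_succ' δ⁻¹ 3, ← mul_assoc, ← mul_assoc, ENNReal.mul_inv_cancel h0 ht, one_mul]
  rw [h, ← h2, ← mul_add]
  gcongr
  have hpq : (4 / 3 : ℝ).HolderConjugate 4 := by
    rw [Real.holderConjugate_iff]; norm_num
  refine (ENNReal.young_inequality _ _ hpq).trans (add_le_add ?_ ?_)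
  · refine (ENNReal.div_le_of_le_mul ?_)
    rw [← ENNReal.rpow_natCast, ← ENNReal.rpow_mul]
    have h1 : (1 : ℝ≥0∞) ≤ ENNReal.ofReal (4 / 3) := by
      rw [← ENNReal.ofReal_one]
      exact ENNReal.ofReal_le_ofReal (by norm_num)
    norm_num
    exact le_mul_of_one_le_right zero_le h1
  · refine (ENNReal.div_le_of_le_mul ?_)
    have h1 : (1 : ℝ≥0∞) ≤ ENNReal.ofReal 4 := by
      rw [← ENNReal.ofReal_one]
      exact ENNReal.ofReal_le_ofReal (by norm_num)
    have h3 : (δ⁻¹ * b) ^ (4 : ℝ) = (δ⁻¹ * b) ^ 4 := by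
      rw [← ENNReal.rpow_natCast]; norm_num
    rw [h3]
    exact le_mul_of_one_le_right zero_le h1

theorem add_pow_four_le (a b : ℝ≥0∞) : (a + b) ^ 4 ≤ 16 * (a ^ 4 + b ^ 4) := by
  rcases le_total a b with h | h
  · calc (a + b) ^ 4 ≤ (b + b) ^ 4 := by gcongr
      _ = 16 * b ^ 4 := by ring
      _ ≤ _ := by gcongr; exact le_add_self
  · calc (a + b) ^ 4 ≤ (a + a) ^ 4 := by gcongr
      _ = 16 * a ^ 4 := by ring
      _ ≤ _ := by gcongr; exact le_self_add

theorem lintegral_pi_eval {E : Type*} [MeasurableSpace E] {μ : Measure E}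
    [IsProbabilityMeasure μ] {r : ℕ} (j : Fin r) {f : E → ℝ≥0∞}
    (hf : Measurable f) : ∫⁻ y : Fin r → E, f (y j) ∂(Measure.pi fun _ => μ) = ∫⁻ x, f x ∂μ :=
  (measurePreserving_eval (fun _ : Fin r => μ) j).lintegral_comp hf

theorem lintegral_pi_eval_eval {E : Type*} [MeasurableSpace E] {μ : Measure E}
    [IsProbabilityMeasure μ] {r : ℕ} {i j : Fin r} (hij : i ≠ j)
    {f : E × E → ℝ≥0∞} (hf : Measurable f) :
    ∫⁻ y : Fin r → E, f (y i, y j) ∂(Measure.pi fun _ => μ) = ∫⁻ x, ∫⁻ x', f (x, x') ∂μ ∂μ := by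
  have hind : iIndepFun (fun (i : Fin r) (y : Fin r → E) => y i) (Measure.pi fun _ => μ) :=
    iIndepFun_pi (X := fun _ => id) fun _ => aemeasurable_id
  have h := (indepFun_iff_map_prod_eq_prod_map_map (measurable_pi_apply i).aemeasurable
    (measurable_pi_apply j).aemeasurable).1
    (hind.indepFun hij)
  rw [(measurePreserving_eval (fun _ : Fin r => μ) i).map_eq,
    (measurePreserving_eval (fun _ : Fin r => μ) j).map_eq] at h
  rw [← lintegral_prod _ hf.aemeasurable, ← h, lintegral_map hf (by fun_prop)]

universe u

variable {H : Type u} [NormedAddCommGroup H] [InnerProductSpace ℝ H]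

/-- The sum of the powers `dist(y_l, span_{i ≠ l} y_i)^{-8/3}`. -/
noncomputable def sumRecip {n : ℕ} (y : Fin (n + 1) → H) : ℝ≥0∞ :=
  ∑ l, recipDist (y l) (fun i => y (l.succAbove i)) ^ (8 / 3 : ℝ)

theorem sumRecip_rpow {n : ℕ} (y : Fin (n + 1) → H) :
    (sumRecip y ^ (3 / 8 : ℝ)) ^ (8 / 3 : ℝ) = sumRecip y := by
  rw [← ENNReal.rpow_mul]; norm_num

/-- If c_l ≠ 0, dividing by c_l shows ‖∑ c_i y_i‖ ≥ |c_l| dist(y_l, span of the others). Thus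
`sumRecip` to the power 3/8 serves as s. -/
theorem abs_le_sumRecip {n : ℕ} {y : Fin (n + 1) → H} (hy : sumRecip y ≠ ∞)
    (c : Fin (n + 1) → ℝ) (l : Fin (n + 1)) :
    |c l| ≤ (sumRecip y ^ (3 / 8 : ℝ)).toReal * ‖∑ i, c i • y i‖ := by
  rcases eq_or_ne (c l) 0 with h0 | h0
  · rw [h0, abs_zero]; positivity
  have hR : sumRecip y ^ (3 / 8 : ℝ) ≠ ∞ := ENNReal.rpow_ne_top_of_nonneg (by norm_num) hy
  have h1 : recipDist (y l) (fun i => y (l.succAbove i)) ≤ sumRecip y ^ (3 / 8 : ℝ) := by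
    have h2 : recipDist (y l) (fun i => y (l.succAbove i)) ^ (8 / 3 : ℝ) ≤ sumRecip y :=
      Finset.single_le_sum (f := fun l => recipDist (y l)
        (fun i => y (l.succAbove i)) ^ (8 / 3 : ℝ)) (fun _ _ => zero_le) (Finset.mem_univ l)
    have h3 := ENNReal.rpow_le_rpow h2 (by norm_num : (0 : ℝ) ≤ 3 / 8)
    rw [← ENNReal.rpow_mul] at h3
    norm_num at h3 ⊢
    exact h3
  set x := y l - ∑ i, (-(c (l.succAbove i) / c l)) • y (l.succAbove i) with hx
  have h2 : (‖x‖ₑ)⁻¹ ≤ sumRecip y ^ (3 / 8 : ℝ) :=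
    (inv_enorm_le_recipDist (y l) (fun i => y (l.succAbove i))
      (fun i => -(c (l.succAbove i) / c l))).trans h1
  have hcx : ∑ i, c i • y i = c l • x := by
    rw [Fin.sum_univ_succAbove _ l, hx, smul_sub, Finset.smul_sum, sub_eq_add_neg,
      ← Finset.sum_neg_distrib]
    congr 1
    refine Finset.sum_congr rfl fun i _ => ?_
    rw [smul_smul, ← neg_smul]
    congr 1
    field_simp
  have hx0 : 0 < ‖x‖ := by
    rw [norm_pos_iff]
    intro hx0
    rw [hx0, enorm_zero, ENNReal.inv_zero, top_le_iff] at h2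
    exact hR h2
  have h3 : ‖x‖⁻¹ ≤ (sumRecip y ^ (3 / 8 : ℝ)).toReal := by
    have h4 := ENNReal.toReal_mono hR h2
    rwa [ENNReal.toReal_inv, toReal_enorm] at h4
  rw [hcx, norm_smul, Real.norm_eq_abs, mul_left_comm]
  refine le_mul_of_one_le_right (abs_nonneg _) ?_
  calc 1 = ‖x‖⁻¹ * ‖x‖ := (inv_mul_cancel₀ hx0.ne').symm
    _ ≤ _ := by gcongr

variable [SecondCountableTopology H] [MeasurableSpace H] [BorelSpace H] {μ : Measure H}

theorem measurable_sumRecip {n : ℕ} : Measurable fun y : Fin (n + 1) → H => sumRecip y := by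
  unfold sumRecip
  refine Finset.measurable_sum _ fun l _ => ?_
  have h : Measurable fun y : Fin (n + 1) → H => (y l, fun i => y (l.succAbove i)) := by fun_prop
  exact (measurable_recipDist.comp h).pow_const _

variable [CompleteSpace H] {T : H →L[ℝ] H}

/-- Fubini with one column singled out: the other n are frozen, and rank n + 3 leaves the three
directions required. -/
theorem IsCenteredGaussian.exists_lintegral_sumRecip_le (hμ : IsCenteredGaussian μ T)
    (hpos : T.IsPositive) (hc : IsCompactOperator T) {n : ℕ}
    (hrank : ((n + 3 : ℕ) : Cardinal) ≤ LinearMap.rank T.toLinearMap) :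
    ∃ C : ℝ≥0∞, C ≠ ∞ ∧ ∫⁻ y : Fin (n + 1) → H, sumRecip y ∂(Measure.pi fun _ => μ) ≤ C := by
  have := hμ.isProbabilityMeasure
  obtain ⟨C, hC, hCle⟩ := hμ.exists_lintegral_recipDist_le hpos hc hrank
  refine ⟨∑ _l : Fin (n + 1), C, ENNReal.sum_ne_top.2 fun _ _ => hC, ?_⟩
  unfold sumRecip
  have hm : ∀ l : Fin (n + 1), Measurable fun y : Fin (n + 1) → H =>
      recipDist (y l) (fun i => y (l.succAbove i)) ^ (8 / 3 : ℝ) := fun l => by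
    have h : Measurable fun y : Fin (n + 1) → H => (y l, fun i => y (l.succAbove i)) := by
      fun_prop
    exact (measurable_recipDist.comp h).pow_const _
  rw [lintegral_finsetSum _ fun l _ => hm l]
  refine Finset.sum_le_sum fun l _ => ?_
  have hmp := measurePreserving_piFinSuccAbove (fun _ : Fin (n + 1) => μ) l
  have hm2 : Measurable fun z : H × (Fin n → H) => recipDist z.1 z.2 ^ (8 / 3 : ℝ) :=
    measurable_recipDist.pow_const _
  have h1 := hmp.lintegral_comp hm2
  refine (le_of_eq h1).trans ?_
  rw [lintegral_prod_symm _ hm2.aemeasurable]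
  refine (lintegral_mono fun y => hCle y).trans ?_
  simp

theorem IsCenteredGaussian.lintegral_enorm_pow_eight_le (hμ : IsCenteredGaussian μ T)
    (hpos : T.IsPositive) (hc : IsCompactOperator T) (A : H →L[ℝ] H) {δ : ℝ≥0∞}
    (hA : hsSq (A ∘L sqrtOp T) ≤ δ) :
    ∫⁻ y, (‖A y‖ₑ ^ 2) ^ 4 ∂μ ≤ gaussianMoment 8 * δ ^ 4 := by
  simp_rw [← pow_mul]
  refine (hμ.lintegral_enorm_pow_le hpos hc A (p := 4) (by norm_num)).trans ?_
  gcongr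

/-- For fixed x the inner variable is normal with standard deviation ‖S K^* x‖; the outer integral
is then a fourth moment of the Gaussian vector S K^* x. -/
theorem IsCenteredGaussian.lintegral_inner_pow_four_le (hμ : IsCenteredGaussian μ T)
    (hpos : T.IsPositive) (hc : IsCompactOperator T) (K : H →L[ℝ] H) {δ : ℝ≥0∞}
    (hK : hsSq (sqrtOp T ∘L K ∘L sqrtOp T) ≤ 4 * δ ^ 2) :
    ∫⁻ x, ∫⁻ x', ‖⟪x, K x'⟫‖ₑ ^ 4 ∂μ ∂μ ≤ 16 * gaussianMoment 4 ^ 2 * δ ^ 4 := by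
  have hSa : (sqrtOp T).adjoint = sqrtOp T := (sqrtOp_spec hpos hc).1.isSelfAdjoint.adjoint_eq
  have h1 : ∀ x, ∫⁻ x', ‖⟪x, K x'⟫‖ₑ ^ 4 ∂μ =
      gaussianMoment 4 * ‖(sqrtOp T ∘L K.adjoint) x‖ₑ ^ 4 := fun x => by
    have h := hμ.lintegral_inner_apply_pow hpos hc K x 2
    simpa only [← pow_mul] using h
  simp_rw [h1]
  rw [lintegral_const_mul _ (by fun_prop)]
  have h2 := hμ.lintegral_enorm_pow_le hpos hc (sqrtOp T ∘L K.adjoint) (p := 2) (by norm_num)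
  have h3 : hsSq ((sqrtOp T ∘L K.adjoint) ∘L sqrtOp T) ≤ 4 * δ ^ 2 := by
    rw [← hsSq_adjoint]
    simpa only [ContinuousLinearMap.adjoint_comp, ContinuousLinearMap.adjoint_adjoint, hSa]
      using hK
  calc gaussianMoment 4 * ∫⁻ x, ‖(sqrtOp T ∘L K.adjoint) x‖ₑ ^ 4 ∂μ
      ≤ gaussianMoment 4 * (gaussianMoment 4 * (4 * δ ^ 2) ^ 2) := by
        gcongr
        exact h2.trans (by gcongr)
    _ = _ := by ring

/-- Distinct columns are independent and the preceding bound applies. On the diagonal independence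
fails, and the identity for 2⟪y, K y⟫ replaces it, costing eighth moments of Q y and K y. -/
theorem IsCenteredGaussian.lintegral_pi_inner_pow_four_le (hμ : IsCenteredGaussian μ T)
    (hpos : T.IsPositive) (hc : IsCompactOperator T) {K Q : H →L[ℝ] H} {δ : ℝ≥0∞}
    (hQ : hsSq (Q ∘L sqrtOp T) ≤ δ) (hK : hsSq (K ∘L sqrtOp T) ≤ δ)
    (hSK : hsSq (sqrtOp T ∘L K ∘L sqrtOp T) ≤ 4 * δ ^ 2)
    (h : ∀ x, 2 * ⟪sqrtOp T x, K (sqrtOp T x)⟫ =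
      ‖Q (sqrtOp T x)‖ ^ 2 + ‖K (sqrtOp T x)‖ ^ 2) {r : ℕ} (i j : Fin r) :
    ∫⁻ y : Fin r → H, ‖⟪y i, K (y j)⟫‖ₑ ^ 4 ∂(Measure.pi fun _ => μ) ≤
      (16 * gaussianMoment 4 ^ 2 + 32 * gaussianMoment 8) * δ ^ 4 := by
  have := hμ.isProbabilityMeasure
  rcases eq_or_ne i j with rfl | hij
  · rw [lintegral_pi_eval (f := fun x => ‖⟪x, K x⟫‖ₑ ^ 4) i (by fun_prop)]
    have h1 : ∀ᵐ x ∂μ, ‖⟪x, K x⟫‖ₑ ^ 4 ≤ 16 * ((‖Q x‖ₑ ^ 2) ^ 4 + (‖K x‖ₑ ^ 2) ^ 4) := by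
      filter_upwards [hμ.ae_two_mul_inner_eq hpos hc h] with x hx
      refine le_trans ?_ (add_pow_four_le _ _)
      refine pow_le_pow_left₀ zero_le ?_ 4
      rw [enorm_sq_eq_ofReal, enorm_sq_eq_ofReal, ← ENNReal.ofReal_add (by positivity)
        (by positivity), ← ofReal_norm, ← hx]
      refine ENNReal.ofReal_le_ofReal ?_
      have h0 : 0 ≤ ⟪x, K x⟫ := by nlinarith [sq_nonneg ‖Q x‖, sq_nonneg ‖K x‖]
      rw [Real.norm_of_nonneg h0]
      linarith
    refine (lintegral_mono_ae h1).trans ?_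
    rw [lintegral_const_mul _ (by fun_prop), lintegral_add_left (by fun_prop)]
    calc 16 * (∫⁻ x, (‖Q x‖ₑ ^ 2) ^ 4 ∂μ + ∫⁻ x, (‖K x‖ₑ ^ 2) ^ 4 ∂μ)
        ≤ 16 * (gaussianMoment 8 * δ ^ 4 + gaussianMoment 8 * δ ^ 4) := by
          gcongr
          · exact hμ.lintegral_enorm_pow_eight_le hpos hc Q hQ
          · exact hμ.lintegral_enorm_pow_eight_le hpos hc K hK
      _ = 32 * gaussianMoment 8 * δ ^ 4 := by ring
      _ ≤ _ := by gcongr; exact le_add_self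
  · rw [lintegral_pi_eval_eval (f := fun z => ‖⟪z.1, K z.2⟫‖ₑ ^ 4) hij (by fun_prop)]
    refine (hμ.lintegral_inner_pow_four_le hpos hc K hSK).trans ?_
    gcongr
    exact le_self_add

end Integration

/-! ### The expected error of the coupling. -/

section Coupling

universe u

variable {H : Type u} [NormedAddCommGroup H] [InnerProductSpace ℝ H] [CompleteSpace H]
  {T : H →L[ℝ] H}

/-- The perturbation bound with (∑ ‖e_j‖)² split into single squares, so that expectations can be
taken term by term. -/
theorem hsNorm_nystrom_sub_le_of_sumRecip_ne_top (hpos : T.IsPositive) (hc : IsCompactOperator T)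
    {n : ℕ} (y e : Fin (n + 1) → H) (hy : sumRecip y ≠ ∞) :
    hsNorm (nystrom T y - nystrom T fun j => y j - e j) ≤ 2 * hsNorm (sqrtOp T) *
      (2 * ∑ j, sumRecip y ^ (3 / 8 : ℝ) * ‖sqrtOp T (e j)‖ₑ +
        4 * ‖sqrtOp T‖ₑ * ∑ i, ∑ j, ((sumRecip y ^ (3 / 8 : ℝ)) ^ 2 * ‖⟪y i, e j⟫‖ₑ +
          (sumRecip y ^ (3 / 8 : ℝ)) ^ 2 * ‖e i‖ₑ ^ 2 +
          (sumRecip y ^ (3 / 8 : ℝ)) ^ 2 * ‖e j‖ₑ ^ 2)) := by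
  have hR : sumRecip y ^ (3 / 8 : ℝ) ≠ ∞ := ENNReal.rpow_ne_top_of_nonneg (by norm_num) hy
  refine (hsNorm_nystrom_sub_le_of_forall_abs_le hpos hc y e ENNReal.toReal_nonneg
    (abs_le_sumRecip hy)).trans ?_
  set R := sumRecip y ^ (3 / 8 : ℝ)
  gcongr
  have hsq : ENNReal.ofReal ((∑ j, ‖e j‖) ^ 2) ≤ ∑ i, ∑ j, (‖e i‖ₑ ^ 2 + ‖e j‖ₑ ^ 2) := by
    rw [ENNReal.ofReal_pow (by positivity), ENNReal.ofReal_sum_of_nonneg fun _ _ => by positivity,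
      sq, Finset.sum_mul_sum]
    refine Finset.sum_le_sum fun i _ => Finset.sum_le_sum fun j _ => ?_
    rw [ofReal_norm, ofReal_norm]
    exact mul_le_sq_add_sq _ _
  have hin : ENNReal.ofReal (∑ i, ∑ j, |⟪y i, e j⟫|) = ∑ i, ∑ j, ‖⟪y i, e j⟫‖ₑ := by
    rw [ENNReal.ofReal_sum_of_nonneg fun _ _ => by positivity]
    refine Finset.sum_congr rfl fun i _ => ?_
    rw [ENNReal.ofReal_sum_of_nonneg fun _ _ => by positivity]
    exact Finset.sum_congr rfl fun j _ => by rw [← Real.norm_eq_abs, ofReal_norm]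
  rw [ENNReal.ofReal_add (by positivity) (by positivity), ENNReal.ofReal_mul (by norm_num),
    ENNReal.ofReal_mul (by positivity), ENNReal.ofReal_mul (by positivity),
    ENNReal.ofReal_mul (by norm_num), ENNReal.ofReal_mul (by positivity),
    ENNReal.ofReal_pow (by positivity), ENNReal.ofReal_toReal hR, ofReal_norm,
    ENNReal.ofReal_add (by positivity) (by positivity), hin,
    ENNReal.ofReal_sum_of_nonneg fun _ _ => by positivity, Finset.mul_sum]
  simp_rw [ofReal_norm]
  refine add_le_add (by simp) ?_
  calc _ ≤ ENNReal.ofReal 4 * ‖sqrtOp T‖ₑ * (R ^ 2 * (∑ i, ∑ j, ‖⟪y i, e j⟫‖ₑ +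
        ∑ i, ∑ j, (‖e i‖ₑ ^ 2 + ‖e j‖ₑ ^ 2))) := by gcongr
    _ = _ := by
      simp_rw [← Finset.sum_add_distrib, Finset.mul_sum, mul_add, add_assoc]
      simp

variable [SecondCountableTopology H] [MeasurableSpace H] [BorelSpace H] {μ : Measure H}

/-- Each product of a power of s with an error term is split by Young at scale δ, and the resulting
factors δ⁻¹·δ² and δ⁻³·δ⁴ collapse to δ. The parameter δ is left free, not set to the trace defect,
because the splitting needs 0 < δ < ∞. -/
theorem IsCenteredGaussian.exists_lintegral_hsNorm_nystrom_sub_le (hμ : IsCenteredGaussian μ T)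
    (hpos : T.IsPositive) (htr : IsTraceClass T) {n : ℕ}
    (hrank : ((n + 3 : ℕ) : Cardinal) ≤ LinearMap.rank T.toLinearMap) :
    ∃ C : ℝ≥0∞, C ≠ ∞ ∧ ∀ (K Q : H →L[ℝ] H) (δ : ℝ≥0∞), δ ≠ 0 → δ ≠ ∞ →
      hsSq (Q ∘L sqrtOp T) ≤ δ → hsSq (K ∘L sqrtOp T) ≤ δ →
      hsSq (sqrtOp T ∘L K ∘L sqrtOp T) ≤ 4 * δ ^ 2 →
      (∀ x, 2 * ⟪sqrtOp T x, K (sqrtOp T x)⟫ =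
        ‖Q (sqrtOp T x)‖ ^ 2 + ‖K (sqrtOp T x)‖ ^ 2) →
      ∫⁻ y : Fin (n + 1) → H, hsNorm (nystrom T y - nystrom T fun j => y j - K (y j))
        ∂(Measure.pi fun _ => μ) ≤ C * δ := by
  have hc := htr.isCompactOperator
  have := hμ.isProbabilityMeasure
  obtain ⟨C₁, hC₁, hle⟩ := hμ.exists_lintegral_sumRecip_le hpos hc hrank
  have hN : hsNorm (sqrtOp T) ≠ ∞ := by
    rw [hsNorm_eq_hsSq_rpow]
    exact ENNReal.rpow_ne_top_of_nonneg (by norm_num) (hsSq_sqrtOp_ne_top hpos htr)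
  have hm4 := gaussianMoment_ne_top 4
  have hm8 := gaussianMoment_ne_top 8
  set M : ℝ≥0∞ := 16 * gaussianMoment 4 ^ 2 + 32 * gaussianMoment 8 with hM
  refine ⟨2 * hsNorm (sqrtOp T) * (2 * ∑ _j : Fin (n + 1), (1 + C₁ + 4) +
    4 * ‖sqrtOp T‖ₑ * ∑ _i : Fin (n + 1), ∑ _j : Fin (n + 1),
      ((C₁ + M) + (C₁ + gaussianMoment 8) + (C₁ + gaussianMoment 8))), ?_, ?_⟩
  · have hMt : M ≠ ∞ := by
      rw [hM]; finiteness
    have : ‖sqrtOp T‖ₑ ≠ ∞ := enorm_ne_top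
    simp only [Finset.sum_const, nsmul_eq_mul]
    finiteness
  intro K Q δ h0 ht hQ hK hSK hid
  set P : Measure (Fin (n + 1) → H) := Measure.pi fun _ => μ with hP
  have hD : Measurable fun y : Fin (n + 1) → H => sumRecip y := measurable_sumRecip
  -- Almost surely the columns are linearly independent, so s is finite and the deterministic bound
  -- applies.
  have hae : ∀ᵐ y ∂P, sumRecip y < ∞ :=
    ae_lt_top hD (ne_top_of_le_ne_top hC₁ hle)
  have hbound : ∀ᵐ y ∂P, hsNorm (nystrom T y - nystrom T fun j => y j - K (y j)) ≤
      2 * hsNorm (sqrtOp T) *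
      (2 * ∑ j, (δ * (1 + sumRecip y) + δ⁻¹ * ‖sqrtOp T (K (y j))‖ₑ ^ 2) +
        4 * ‖sqrtOp T‖ₑ * ∑ i, ∑ j, ((δ * sumRecip y + δ⁻¹ ^ 3 * ‖⟪y i, K (y j)⟫‖ₑ ^ 4) +
          (δ * sumRecip y + δ⁻¹ ^ 3 * (‖K (y i)‖ₑ ^ 2) ^ 4) +
          (δ * sumRecip y + δ⁻¹ ^ 3 * (‖K (y j)‖ₑ ^ 2) ^ 4))) := by
    filter_upwards [hae] with y hy
    have hs1 : ∀ b : ℝ≥0∞, sumRecip y ^ (3 / 8 : ℝ) * b ≤ δ * (1 + sumRecip y) + δ⁻¹ * b ^ 2 :=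
      fun b => by
        have := mul_le_of_scale (sumRecip y ^ (3 / 8 : ℝ)) b h0 ht
        rwa [sumRecip_rpow] at this
    have hs2 : ∀ b : ℝ≥0∞,
        (sumRecip y ^ (3 / 8 : ℝ)) ^ 2 * b ≤ δ * sumRecip y + δ⁻¹ ^ 3 * b ^ 4 := fun b => by
      have := sq_mul_le_of_scale (sumRecip y ^ (3 / 8 : ℝ)) b h0 ht
      rwa [sumRecip_rpow] at this
    refine (hsNorm_nystrom_sub_le_of_sumRecip_ne_top hpos hc y _ hy.ne).trans ?_
    gcongr <;> first | exact hs1 _ | exact hs2 _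
  have hδ3 : δ⁻¹ ^ 3 * δ ^ 4 = δ := by
    rw [pow_succ δ 3, ← mul_assoc, ← mul_pow, ENNReal.inv_mul_cancel h0 ht, one_pow, one_mul]
  have hδ1 : δ⁻¹ * (4 * δ ^ 2) = 4 * δ := by
    rw [mul_left_comm, sq, ← mul_assoc δ⁻¹, ENNReal.inv_mul_cancel h0 ht, one_mul]
  have hI1 : ∀ j, ∫⁻ y, (δ * (1 + sumRecip y) + δ⁻¹ * ‖sqrtOp T (K (y j))‖ₑ ^ 2) ∂P ≤
      (1 + C₁ + 4) * δ := fun j => by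
    rw [lintegral_add_left (by fun_prop), lintegral_const_mul _ (by fun_prop),
      lintegral_const_mul _ (by fun_prop), lintegral_add_left (by fun_prop),
      lintegral_pi_eval (f := fun x => ‖sqrtOp T (K x)‖ₑ ^ 2) j (by fun_prop)]
    calc _ ≤ δ * (1 + C₁) + δ⁻¹ * (4 * δ ^ 2) := by
          gcongr
          · simp
          · exact (hμ.lintegral_enorm_sq hpos hc (sqrtOp T ∘L K)).trans_le hSK
      _ = _ := by rw [hδ1]; ring
  have hI2 : ∀ i j, ∫⁻ y, (δ * sumRecip y + δ⁻¹ ^ 3 * ‖⟪y i, K (y j)⟫‖ₑ ^ 4) ∂P ≤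
      (C₁ + M) * δ := fun i j => by
    rw [lintegral_add_left (by fun_prop), lintegral_const_mul _ (by fun_prop),
      lintegral_const_mul _ (by fun_prop)]
    calc _ ≤ δ * C₁ + δ⁻¹ ^ 3 * (M * δ ^ 4) := by
          gcongr
          exact hμ.lintegral_pi_inner_pow_four_le hpos hc hQ hK hSK hid i j
      _ = _ := by rw [mul_left_comm, hδ3]; ring
  have hI3 : ∀ j, ∫⁻ y, (δ * sumRecip y + δ⁻¹ ^ 3 * (‖K (y j)‖ₑ ^ 2) ^ 4) ∂P ≤
      (C₁ + gaussianMoment 8) * δ := fun j => by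
    rw [lintegral_add_left (by fun_prop), lintegral_const_mul _ (by fun_prop),
      lintegral_const_mul _ (by fun_prop),
      lintegral_pi_eval (f := fun x => (‖K x‖ₑ ^ 2) ^ 4) j (by fun_prop)]
    calc _ ≤ δ * C₁ + δ⁻¹ ^ 3 * (gaussianMoment 8 * δ ^ 4) := by
          gcongr
          exact hμ.lintegral_enorm_pow_eight_le hpos hc K hK
      _ = _ := by rw [mul_left_comm, hδ3]; ring
  refine (lintegral_mono_ae hbound).trans ?_
  rw [lintegral_const_mul _ (by fun_prop), lintegral_add_left (by fun_prop),
    lintegral_const_mul _ (by fun_prop), lintegral_const_mul _ (by fun_prop),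
    lintegral_finsetSum _ (fun _ _ => by fun_prop), lintegral_finsetSum _ (fun _ _ => by fun_prop)]
  have hI : ∀ i, ∫⁻ y, ∑ j, ((δ * sumRecip y + δ⁻¹ ^ 3 * ‖⟪y i, K (y j)⟫‖ₑ ^ 4) +
          (δ * sumRecip y + δ⁻¹ ^ 3 * (‖K (y i)‖ₑ ^ 2) ^ 4) +
          (δ * sumRecip y + δ⁻¹ ^ 3 * (‖K (y j)‖ₑ ^ 2) ^ 4)) ∂P ≤
      (∑ _j : Fin (n + 1), ((C₁ + M) + (C₁ + gaussianMoment 8) + (C₁ + gaussianMoment 8))) * δ :=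
    fun i => by
      rw [lintegral_finsetSum _ (fun _ _ => by fun_prop), Finset.sum_mul]
      refine Finset.sum_le_sum fun j _ => ?_
      rw [lintegral_add_left (by fun_prop), lintegral_add_left (by fun_prop), add_mul, add_mul]
      exact add_le_add (add_le_add (hI2 i j) (hI3 i)) (hI3 j)
  calc _ ≤ 2 * hsNorm (sqrtOp T) * (2 * ∑ _j : Fin (n + 1), (1 + C₁ + 4) * δ +
        4 * ‖sqrtOp T‖ₑ * ∑ _i : Fin (n + 1), (∑ _j : Fin (n + 1),
          ((C₁ + M) + (C₁ + gaussianMoment 8) + (C₁ + gaussianMoment 8))) * δ) := by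
        gcongr with j _ i _
        · exact hI1 j
        · exact hI i
    _ = _ := by
      rw [← Finset.sum_mul, ← Finset.sum_mul]
      ring

end Coupling

/-! ### Passage to the infimum over couplings, and convergence of the traces. -/

section Distance

universe u

variable {H : Type u} [NormedAddCommGroup H] [InnerProductSpace ℝ H] [CompleteSpace H]
  {T : H →L[ℝ] H}

theorem hasSum_inner_apply_self (hpos : T.IsPositive) (htr : IsTraceClass T) {ι : Type*}
    (b : HilbertBasis ι ℝ H) : HasSum (fun i => ⟪b i, T (b i)⟫) (opTrace T) := by
  have hc := htr.isCompactOperator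
  have h0 : ∀ i, 0 ≤ ⟪b i, T (b i)⟫ := fun i => hpos.inner_nonneg_right _
  rw [opTrace_eq hpos htr b]
  refine Summable.hasSum ?_
  have h : ∑' i, ENNReal.ofReal ⟪b i, T (b i)⟫ ≠ ∞ := by
    simp_rw [ofReal_inner_eq hpos hc, ← hsSq_eq b]
    exact hsSq_sqrtOp_ne_top hpos htr
  refine (ENNReal.summable_toReal h).congr fun i => ?_
  rw [ENNReal.toReal_ofReal (h0 i)]

theorem tendsto_compressedTrace (hpos : T.IsPositive) (htr : IsTraceClass T) {w : ℕ → H}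
    (hw : Orthonormal ℝ w) (hd : (Submodule.span ℝ (Set.range w)).topologicalClosure = ⊤) :
    Tendsto (fun n : ℕ => compressedTrace T fun i : Fin n => w i) atTop (𝓝 (opTrace T)) := by
  have h := (hasSum_inner_apply_self hpos htr (HilbertBasis.mk hw hd.ge)).tendsto_sum_nat
  refine h.congr fun n => ?_
  rw [compressedTrace_eq_sum, ← Fin.sum_univ_eq_sum_range]
  simp

variable [SecondCountableTopology H] [MeasurableSpace H] [BorelSpace H] {μ : Measure H}

theorem IsCenteredGaussian.map_prodMk_mem_gaussianCouplings (hμ : IsCenteredGaussian μ T)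
    (V : H →L[ℝ] H) :
    μ.map (fun y => (V y, y)) ∈ gaussianCouplings (V ∘L T ∘L V.adjoint) T := by
  have := hμ.isProbabilityMeasure
  refine ⟨Measure.isProbabilityMeasure_map (by fun_prop), ?_, ?_⟩
  · rw [Measure.map_map (by fun_prop) (by fun_prop)]
    exact hμ.map V
  · rw [Measure.map_map (by fun_prop) (by fun_prop)]
    have h : (Prod.snd ∘ fun y : H => (V y, y)) = id := rfl
    rwa [h, Measure.map_id]

/-- The product of the pair laws is the image of the product of μ under y ↦ (V y, y) in each column.
Only the inequality for integrals of image measures is used, so measurability of the integrand plays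
no role. -/
theorem IsCenteredGaussian.nystromDist_le_lintegral (hμ : IsCenteredGaussian μ T) {n : ℕ}
    {w : Fin n → H} {V : H →L[ℝ] H} (hV : V ∘L T ∘L V.adjoint = discreteCov T w) (r : ℕ) :
    nystromDist T r w ≤ ∫⁻ y : Fin r → H, hsNorm (nystrom T y - nystrom T fun j => V (y j))
      ∂(Measure.pi fun _ => μ) := by
  have := hμ.isProbabilityMeasure
  refine (iInf₂_le _ (hV ▸ hμ.map_prodMk_mem_gaussianCouplings V)).trans ?_
  have : IsProbabilityMeasure (μ.map fun y => (V y, y)) :=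
    Measure.isProbabilityMeasure_map (by fun_prop)
  rw [← Measure.pi_map_pi (fun _ => by fun_prop)]
  exact lintegral_map_le _ _

theorem exists_nystromDist_le_mul (hpos : T.IsPositive) (htr : IsTraceClass T) (r : ℕ)
    (hrank : ((r + 2 : ℕ) : Cardinal) ≤ LinearMap.rank T.toLinearMap) :
    ∃ C : ℝ≥0∞, C ≠ ∞ ∧ ∀ (n : ℕ) (w : Fin n → H), Orthonormal ℝ w →
      nystromDist T r w ≤ C * ENNReal.ofReal (opTrace T - compressedTrace T w) := by
  have hc := htr.isCompactOperator
  obtain ⟨μ, hμ⟩ := exists_isCenteredGaussian hpos htr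
  cases r with
  | zero =>
    refine ⟨0, by simp, fun n w hw => ?_⟩
    obtain ⟨V, hV, -⟩ := exists_couplingOp hpos hc hw
    refine (hμ.nystromDist_le_lintegral hV 0).trans ?_
    have h : ∀ y : Fin 0 → H, hsNorm (nystrom T y - nystrom T fun j => V (y j)) = 0 := fun y => by
      rw [Subsingleton.elim (fun j => V (y j)) y, sub_self, hsNorm]
      simp
    simp [h]
  | succ m =>
    obtain ⟨C, hC, hle⟩ := hμ.exists_lintegral_hsNorm_nystrom_sub_le hpos htr hrank
    refine ⟨C, hC, fun n w hw => ?_⟩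
    obtain ⟨V, hV, hK, hSK, hid⟩ := exists_couplingOp hpos hc hw
    have hδ : ∀ δ : ℝ≥0∞, δ ≠ 0 → δ ≠ ∞ → hsSq (complProj w ∘L sqrtOp T) ≤ δ →
        nystromDist T (m + 1) w ≤ C * δ := fun δ h0 ht h => by
      refine (hμ.nystromDist_le_lintegral hV _).trans ?_
      have := hle (1 - V) (complProj w) δ h0 ht h (hK.trans h) (hSK.trans (by gcongr)) hid
      simpa using this
    rw [← hsSq_complProj_comp_sqrtOp hpos htr hw]
    have ht : hsSq (complProj w ∘L sqrtOp T) ≠ ∞ := by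
      rw [hsSq_complProj_comp_sqrtOp hpos htr hw]
      exact ENNReal.ofReal_ne_top
    -- If the trace defect vanishes, the bound C δ holds for every small δ > 0, and δ tends to 0.
    rcases eq_or_ne (hsSq (complProj w ∘L sqrtOp T)) 0 with h | h
    · rw [h, mul_zero]
      have hlim : Tendsto (fun δ : ℝ≥0∞ => C * δ) (𝓝[>] 0) (𝓝 (C * 0)) :=
        (ENNReal.Tendsto.const_mul tendsto_id (Or.inr hC)).mono_left nhdsWithin_le_nhds
      rw [mul_zero] at hlim
      refine ge_of_tendsto hlim ?_
      filter_upwards [Ioo_mem_nhdsGT (zero_lt_one' ℝ≥0∞)] with δ hδ'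
      exact hδ δ hδ'.1.ne' (hδ'.2.trans ENNReal.one_lt_top).ne (h ▸ zero_le)
    · exact hδ _ h ht le_rfl

end Distance

end Nystrom

theorem mainTheorem6 {H : Type*} [NormedAddCommGroup H] [InnerProductSpace ℝ H] [CompleteSpace H]
    [SecondCountableTopology H] [MeasurableSpace H] [BorelSpace H]
    (T : H →L[ℝ] H) (hpos : T.IsPositive) (htr : Nystrom.IsTraceClass T) (k p : ℕ)
    (hrank : ((k + p + 2 : ℕ) : Cardinal) ≤ LinearMap.rank T.toLinearMap) :
    (∃ C : ℝ, ∀ (n : ℕ) (w : Fin n → H), Orthonormal ℝ w →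
      Nystrom.nystromDist T (k + p) w ≤
        ENNReal.ofReal (C * (Nystrom.opTrace T - Nystrom.compressedTrace T w))) ∧
    (∀ w : ℕ → H, Orthonormal ℝ w →
      (Submodule.span ℝ (Set.range w)).topologicalClosure = ⊤ →
      Tendsto (fun n : ℕ => Nystrom.nystromDist T (k + p) (fun i : Fin n => w i))
        atTop (𝓝 0)) := by
  obtain ⟨C, hC, hle⟩ := Nystrom.exists_nystromDist_le_mul hpos htr (k + p) hrank
  refine ⟨⟨C.toReal, fun n w hw => ?_⟩, fun w hw hd => ?_⟩
  · rw [ENNReal.ofReal_mul ENNReal.toReal_nonneg, ENNReal.ofReal_toReal hC]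
    exact hle n w hw
  -- Completeness of the system makes the trace defect tend to 0, and C does not depend on n.
  · have h := (Nystrom.tendsto_compressedTrace hpos htr hw hd).const_sub (Nystrom.opTrace T)
    have h2 := ENNReal.Tendsto.const_mul (a := C) (ENNReal.tendsto_ofReal h) (Or.inr hC)
    rw [sub_self, ENNReal.ofReal_zero, mul_zero] at h2
    exact tendsto_of_tendsto_of_tendsto_of_le_of_le tendsto_const_nhds h2 (fun _ => zero_le)
      fun n => hle n _ (hw.comp _ Fin.val_injective)
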